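/- **Setting.** Role terms are built from identifiers and role names by applying function symbols to finite lists of terms (long-term keys), pairing $(x,y)$ and encryption $\{x\}_y$. Run terms are built in the same way from agent names and nonce run terms, i.e. terms $x\sharp rid$ ($x$ an identifier, $rid$ a run identifier from a fixed infinite set) and intruder-generated terms. Function terms have inverse keys, obtained by exchanging a function symbol with its paired symbol; every other term is its own inverse key. Events are $\mathrm{create}_\ell(r)$, $\mathrm{send}_\ell(r,r',x)$, $\mathrm{read}_\ell(r',r,x)$, $\mathrm{claim}_\ell(r,cl[,x])$, $\mathrm{end}_\ell(r)$. A role specification of $r$ is a list of events executed by $r$ that starts with its only create and ends with its only end event, together with a typing of (at least) the identifiers that appear in it as constant, variable or parameter. A protocol $P$ is a partial map from role names to role specifications with unique labels, except that corresponding send and read events share theirs; in a protocol set every label is used in at most one protocol. $\mathrm{Id}(P)$ is the set of identifiers typed in $P$. An instantiation is a triple $(rid,\rho,\sigma)$ with $\rho$ a partial map from roles to agents and $\sigma$ a partial map from identifiers to nonce run terms; it sends a role $r$ to $\rho(r)$, a constant $x$ to $x\sharp rid$, and a variable or parameter $x$ to $\sigma(x)$. A run of $P$ is created, with a run identifier not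 used by any other run, with $\operatorname{dom}\rho=\operatorname{dom}P$ and $\sigma$ defined exactly at the parameters of the role. It then executes its events in order: a send adds the instantiated message to the intruder knowledge, which is closed under pairing, projection, encryption, and decryption with the inverse key; a read takes a message from the intruder knowledge that matches the pattern and binds the unassigned variables of the pattern; end and claim events are always executable. $\mathrm{Tr}(\Pi)$ is the set of finite sequences of run events (instantiation, event) generated in this way by the protocol set $\Pi$ from the initial intruder knowledge $IK_0(\Pi)$, which is closed, contains all intruder-generated terms and contains no term in which some $x\sharp rid$ occurs. An equation between instantiated terms means that both sides are defined and equal. Let $\ell$ be the label of a claim event of role $r$ with argument $m$ in a protocol $R\in\Pi$, executed in a trace $\alpha$ with instantiation $inst$. * *session-unique* holds if any two claim events $\mathrm{claim}_\ell(r,\cdot,\cdot)$ of $\alpha$ with instantiations $inst_i,inst_j$ such that $inst_i(m)=inst_j(m)=inst(m)$ are the same event of $\alpha$. * *data-agree* holds if there are a map $\kappa$ from $\operatorname{dom}R$ to run identifiers and a $\rho$ such that for every $r'\in\operatorname{dom}R$ the trace $\alpha$ contains a create event of role $r'$ of $R$ with run identifier $\kappa(r')$ and role assignment $\rho$, and an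 event with run identifier $\kappa(r')$ whose instantiation $inst'$ satisfies $inst'(m)=inst(m)$. A system (a protocol set, possibly with its traces restricted) *satisfies* the claim $\ell$ if in each of its traces every claim event with label $\ell$ whose $\rho$ takes only trusted agents as values has the claimed property. $P$ *establishes* $c$ if in every trace of every protocol set containing $P$ the instantiation of every end event of $P$ is defined at $c$. The system $\{P^{\to c},\,Q^{\leftarrow c}_{d!}\}\cup\Pi$ consists of the traces of $\{P,Q\}\cup\Pi$ with unique input from $P$ to $Q$: for every role $r$, role assignment $\rho$ and run term $t$ there is an injection $f$ from the positions of the create events of role $r$ of $Q$ with role assignment $\rho$ and value $t$ at $d$ into the positions of the end events of role $r$ of $P$ with role assignment $\rho$ and value $t$ at $c$, such that $f(j)<j$ for all $j$. If $\operatorname{dom}P=\operatorname{dom}Q$, $\mathrm{Id}(P)\cap\mathrm{Id}(Q)=\emptyset$, $P$ establishes $c$ and $d$ is a parameter in all roles of $Q$, the *chaining composition* $P\cdot Q[c/d]$ maps each role $r$ to the event list of $P(r)$ without its end event followed by the event list of $Q(r)$ without its create event and with $d$ replaced by $c$. An identifier has its type in $P(r)$ if that is defined, and otherwise its type in $Q(r)[c/d]$.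 All events are relabelled along a map that is injective on the labels of $P$ and $Q$. **Theorem.** Let $P,Q$ be protocols such that $P$ establishes $c$, $d$ is a parameter in all roles of $Q$ and $P\cdot Q[c/d]$ is defined. Let $\Pi$ be a set of protocols with $P,Q\notin\Pi$ such that $\{P,Q\}\cup\Pi$ and $\{P\cdot Q[c/d]\}\cup\Pi$ are protocol sets and $IK_0(\{P\cdot Q[c/d]\}\cup\Pi)\subseteq IK_0(\{P,Q\}\cup\Pi)$ (for instance, the initial intruder knowledge is the same for both). Let $\ell$ be the label of a session-unique or data-agree claim event in $P$ or $Q$, and let $\ell'$ be the corresponding label in $P\cdot Q[c/d]$. If $\{P^{\to c},\,Q^{\leftarrow c}_{d!}\}\cup\Pi$ satisfies $\ell$, then $\{P\cdot Q[c/d]\}\cup\Pi$ satisfies $\ell'$. -/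

import Mathlib

universe u

namespace SecProt

/-! ### Terms -/

/-- The sets over which everything is built. `invFunc` pairs the function symbols of mutually
inverse long-term keys (`pk` with `sk`; a symbol for symmetric keys is paired with itself).
`trusted` is the set of trusted agents; all other agents are untrusted. -/
structure Signature where
  Ident : Type u
  Role : Type u
  Func : Type u
  Label : Type u
  OtherClaim : Type u
  Agent : Type u
  RunId : Type u
  Fresh : Type u
  invFunc : Func → Func
  invFunc_invFunc : ∀ f, invFunc (invFunc f) = f
  trusted : Set Agent
  infinite_runId : Infinite RunId

/-- Terms over function symbols `F` and atoms `A`: atoms, functions applied to finitely many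
terms, pairs `(x, y)` and encryptions `{x}_y`. -/
inductive Term (F A : Type u) : Type u
  | atom (a : A) : Term F A
  | fn (f : F) {n : ℕ} (args : Fin n → Term F A) : Term F A
  | pair (x y : Term F A) : Term F A
  | enc (x y : Term F A) : Term F A

variable {F A B : Type u}

/-- The set of atoms that occur in a term (at any depth). -/
def Term.atoms : Term F A → Set A
  | .atom a => {a}
  | .fn _ args => ⋃ i, (args i).atoms
  | .pair x y => x.atoms ∪ y.atoms
  | .enc x y => x.atoms ∪ y.atoms

/-- Replacement of atoms by atoms. -/
def Term.map (g : A → B) : Term F A → Term F B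
  | .atom a => .atom (g a)
  | .fn f args => .fn f (fun i => (args i).map g)
  | .pair x y => .pair (x.map g) (y.map g)
  | .enc x y => .enc (x.map g) (y.map g)

/-- Replacement of atoms along a partial function; defined if and only if the partial function is
defined at every atom of the term. -/
def Term.pmap (g : A → Option B) : Term F A → Option (Term F B)
  | .atom a => (g a).map .atom
  | .fn f args =>
      if h : ∀ i, ((args i).pmap g).isSome = true then
        some (.fn f (fun i => ((args i).pmap g).get (h i)))
      else none
  | .pair x y => (x.pmap g).bind fun x' => (y.pmap g).map fun y' => .pair x' y'
  | .enc x y => (x.pmap g).bind fun x' => (y.pmap g).map fun y' => .enc x' y'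

/-- Atoms of role terms: identifiers and role names. -/
inductive RoleAtom (S : Signature.{u}) : Type u
  | ident (x : S.Ident) : RoleAtom S
  | role (r : S.Role) : RoleAtom S

/-- Nonce run terms: `x♯rid` and intruder-generated terms. -/
inductive Nonce (S : Signature.{u}) : Type u
  | run (x : S.Ident) (rid : S.RunId) : Nonce S
  | intruder (n : S.Fresh) : Nonce S

/-- Atoms of run terms: agent names and nonce run terms. -/
inductive RunAtom (S : Signature.{u}) : Type u
  | agent (a : S.Agent) : RunAtom S
  | nonce (n : Nonce S) : RunAtom S

abbrev RoleTerm (S : Signature.{u}) : Type u := Term S.Func (RoleAtom S)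

abbrev RunTerm (S : Signature.{u}) : Type u := Term S.Func (RunAtom S)

variable {S : Signature.{u}}

/-- The inverse of a key: the paired long-term key for a function term, the term itself for any
other (symmetric) key. -/
def invKey : RunTerm S → RunTerm S
  | .fn f args => .fn (S.invFunc f) args
  | t => t

/-! ### Role specifications and protocols -/

inductive IdType
  | const
  | param
  | var

inductive ClaimName (S : Signature.{u}) : Type u
  | sessionUnique : ClaimName S
  | dataAgree : ClaimName S
  | other (c : S.OtherClaim) : ClaimName S

/-- Events. In both `send l a b x` and `read l a b x`, `a` is the sender and `b` the recipient.
`finish` is the `end` event. -/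
inductive Event (S : Signature.{u}) : Type u
  | create (l : S.Label) (r : S.Role) : Event S
  | send (l : S.Label) (a b : S.Role) (x : RoleTerm S) : Event S
  | read (l : S.Label) (a b : S.Role) (x : RoleTerm S) : Event S
  | claim (l : S.Label) (r : S.Role) (cl : ClaimName S) (x : Option (RoleTerm S)) : Event S
  | finish (l : S.Label) (r : S.Role) : Event S

namespace Event

def label : Event S → S.Label
  | .create l _ => l
  | .send l _ _ _ => l
  | .read l _ _ _ => l
  | .claim l _ _ _ => l
  | .finish l _ => l

/-- The identifiers that appear in an event. -/
def idents : Event S → Set S.Ident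
  | .create _ _ => ∅
  | .send _ _ _ x => {y | RoleAtom.ident y ∈ x.atoms}
  | .read _ _ _ x => {y | RoleAtom.ident y ∈ x.atoms}
  | .claim _ _ _ none => ∅
  | .claim _ _ _ (some x) => {y | RoleAtom.ident y ∈ x.atoms}
  | .finish _ _ => ∅

/-- `e` is a send, read or claim event that is executed by role `r`. -/
def IsBodyOf (r : S.Role) : Event S → Prop
  | .create _ _ => False
  | .send _ a _ _ => a = r
  | .read _ _ b _ => b = r
  | .claim _ r' _ _ => r' = r
  | .finish _ _ => False

/-- Apply `f` to the label and `g` to the message or claim argument. -/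
def map (f : S.Label → S.Label) (g : RoleTerm S → RoleTerm S) : Event S → Event S
  | .create l r => .create (f l) r
  | .send l a b x => .send (f l) a b (g x)
  | .read l a b x => .read (f l) a b (g x)
  | .claim l r cl x => .claim (f l) r cl (x.map g)
  | .finish l r => .finish (f l) r

/-- A send event and a read event with the same label, sender and recipient. -/
def Corresponding (e e' : Event S) : Prop :=
  ∃ l a b x y, e = .send l a b x ∧ e' = .read l a b y

end Event

/-- A list of events with a (partial) typing of identifiers. -/
structure RoleSpec (S : Signature.{u}) : Type u where
  events : List (Event S)
  typ : S.Ident → Option IdType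

/-- The requirements on a specification of the role `r`. -/
def RoleSpec.WellFormed (rs : RoleSpec S) (r : S.Role) : Prop :=
  (∃ l body l', rs.events = .create l r :: (body ++ [.finish l' r]) ∧ ∀ e ∈ body, e.IsBodyOf r) ∧
  ∀ e ∈ rs.events, ∀ x ∈ e.idents, (rs.typ x).isSome = true

/-- `Var_rs(m)`: the identifiers in `m` that are variables in the role specification. -/
def RoleSpec.varsIn (rs : RoleSpec S) (m : RoleTerm S) : Set S.Ident :=
  {x | RoleAtom.ident x ∈ m.atoms ∧ rs.typ x = some .var}

/-- A partial map from role names to role specifications. -/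
abbrev Protocol (S : Signature.{u}) : Type u := S.Role → Option (RoleSpec S)

namespace Protocol

def dom (P : Protocol S) : Set S.Role := {r | (P r).isSome = true}

def labels (P : Protocol S) : Set S.Label :=
  {l | ∃ r rs, P r = some rs ∧ ∃ e ∈ rs.events, e.label = l}

/-- The identifiers of a protocol: those that are given a type by one of its roles. -/
def idents (P : Protocol S) : Set S.Ident :=
  {x | ∃ r rs, P r = some rs ∧ (rs.typ x).isSome = true}

/-- All roles are well-formed, and labels are unique except that a send event and the
corresponding read event share theirs. -/
def WellFormed (P : Protocol S) : Prop :=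
  (∀ r rs, P r = some rs → rs.WellFormed r) ∧
  ∀ r₁ rs₁ (i₁ : ℕ) e₁ r₂ rs₂ (i₂ : ℕ) e₂, P r₁ = some rs₁ → rs₁.events[i₁]? = some e₁ →
    P r₂ = some rs₂ → rs₂.events[i₂]? = some e₂ → e₁.label = e₂.label →
    (r₁ = r₂ ∧ i₁ = i₂) ∨ Event.Corresponding e₁ e₂ ∨ Event.Corresponding e₂ e₁

end Protocol

/-- Protocol sets: every label is used in at most one protocol. -/
def IsProtocolSet (Ps : Set (Protocol S)) : Prop :=
  (∀ P ∈ Ps, P.WellFormed) ∧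
  ∀ P ∈ Ps, ∀ Q ∈ Ps, P ≠ Q → Disjoint P.labels Q.labels

/-! ### Instantiations, runs and traces -/

/-- Instantiations `(rid, ρ, σ)`; `σ` assigns only nonce run terms. -/
structure Inst (S : Signature.{u}) : Type u where
  rid : S.RunId
  ρ : S.Role → Option S.Agent
  σ : S.Ident → Option (Nonce S)

def Inst.atomValue (inst : Inst S) (typ : S.Ident → Option IdType) :
    RoleAtom S → Option (RunAtom S)
  | .role r => (inst.ρ r).map .agent
  | .ident x =>
      match typ x with
      | some .const => some (.nonce (.run x inst.rid))
      | some .param => (inst.σ x).map .nonce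
      | some .var => (inst.σ x).map .nonce
      | none => none

/-- `inst(x)` in the context of the role specification `rs`; `none` if it is undefined. -/
def Inst.apply (inst : Inst S) (rs : RoleSpec S) (x : RoleTerm S) : Option (RunTerm S) :=
  x.pmap (inst.atomValue rs.typ)

/-- A run of the role specification `spec`: an instantiation and the remaining events. -/
structure Run (S : Signature.{u}) : Type u where
  spec : RoleSpec S
  inst : Inst S
  rest : List (Event S)

structure RunEvent (S : Signature.{u}) : Type u where
  inst : Inst S
  ev : Event S

abbrev Trace (S : Signature.{u}) : Type u := List (RunEvent S)

/-- `inst` is the instantiation of an initial run of the role specification `rs` of `P`. -/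
def IsInitial (P : Protocol S) (rs : RoleSpec S) (inst : Inst S) : Prop :=
  (∀ r, (inst.ρ r).isSome = true ↔ r ∈ P.dom) ∧
  ∀ x, (inst.σ x).isSome = true ↔ rs.typ x = some .param

/-- Closure of intruder knowledge: the smallest closed superset. -/
inductive Derivable (K : Set (RunTerm S)) : RunTerm S → Prop
  | base {t} : t ∈ K → Derivable K t
  | pair {t v} : Derivable K t → Derivable K v → Derivable K (.pair t v)
  | left {t v} : Derivable K (.pair t v) → Derivable K t
  | right {t v} : Derivable K (.pair t v) → Derivable K v
  | encrypt {t v} : Derivable K t → Derivable K v → Derivable K (.enc t v)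
  | decrypt {t v} : Derivable K (.enc t v) → Derivable K (invKey v) → Derivable K t

def knowledgeClosure (K : Set (RunTerm S)) : Set (RunTerm S) := {t | Derivable K t}

/-- Initial intruder knowledge is closed, contains all intruder-generated terms, and contains
nothing that is only generated during the execution of the system. -/
structure IsInitialKnowledge (K : Set (RunTerm S)) : Prop where
  closed : knowledgeClosure K = K
  intruder : ∀ n, Term.atom (.nonce (.intruder n)) ∈ K
  noRun : ∀ t ∈ K, ∀ x rid, RunAtom.nonce (.run x rid) ∉ t.atoms

/-- `Match(inst, m, t, inst')` in the context of `rs`. -/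
def Matches (rs : RoleSpec S) (inst : Inst S) (m : RoleTerm S) (t : RunTerm S)
    (inst' : Inst S) : Prop :=
  inst'.rid = inst.rid ∧ inst'.ρ = inst.ρ ∧
  (∀ x v, inst.σ x = some v → inst'.σ x = some v) ∧
  (∀ x, (inst'.σ x).isSome = true ↔ ((inst.σ x).isSome = true ∨ x ∈ rs.varsIn m)) ∧
  inst'.apply rs m = some t

/-- Intruder knowledge, and all runs that have been created. -/
structure State (S : Signature.{u}) : Type u where
  know : Set (RunTerm S)
  runs : Set (Run S)

/-- `F[run'/run]` -/
def replaceRun (F : Set (Run S)) (run run' : Run S) : Set (Run S) := insert run' (F \ {run})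

/-- The derivation rules of the system that executes the protocol set `Ps`. -/
inductive Step (Ps : Set (Protocol S)) : State S → RunEvent S → State S → Prop
  | create {K F P r rs inst l rest} :
      P ∈ Ps → P r = some rs → rs.events = .create l r :: rest → IsInitial P rs inst →
      (∀ run ∈ F, run.inst.rid ≠ inst.rid) →
      Step Ps ⟨K, F⟩ ⟨inst, .create l r⟩ ⟨K, insert ⟨rs, inst, rest⟩ F⟩
  | finish {K F rs inst l r} :
      ⟨rs, inst, [.finish l r]⟩ ∈ F →
      Step Ps ⟨K, F⟩ ⟨inst, .finish l r⟩
        ⟨K, replaceRun F ⟨rs, inst, [.finish l r]⟩ ⟨rs, inst, []⟩⟩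
  | send {K F rs inst l a b m rest t} :
      ⟨rs, inst, .send l a b m :: rest⟩ ∈ F → inst.apply rs m = some t →
      Step Ps ⟨K, F⟩ ⟨inst, .send l a b m⟩
        ⟨knowledgeClosure (insert t K),
          replaceRun F ⟨rs, inst, .send l a b m :: rest⟩ ⟨rs, inst, rest⟩⟩
  | read {K F rs inst l a b m rest t inst'} :
      ⟨rs, inst, .read l a b m :: rest⟩ ∈ F → t ∈ K → Matches rs inst m t inst' →
      Step Ps ⟨K, F⟩ ⟨inst', .read l a b m⟩
        ⟨K, replaceRun F ⟨rs, inst, .read l a b m :: rest⟩ ⟨rs, inst', rest⟩⟩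
  | claim {K F rs inst l r cl x rest} :
      ⟨rs, inst, .claim l r cl x :: rest⟩ ∈ F →
      Step Ps ⟨K, F⟩ ⟨inst, .claim l r cl x⟩
        ⟨K, replaceRun F ⟨rs, inst, .claim l r cl x :: rest⟩ ⟨rs, inst, rest⟩⟩

inductive Derivation (Ps : Set (Protocol S)) : State S → Trace S → State S → Prop
  | nil (s) : Derivation Ps s [] s
  | cons {s e s' α s''} : Step Ps s e s' → Derivation Ps s' α s'' → Derivation Ps s (e :: α) s''

/-- `Tr(Ps)`. The initial intruder knowledge `IK₀ Ps` may depend on the protocol set. -/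
def traces (IK₀ : Set (Protocol S) → Set (RunTerm S)) (Ps : Set (Protocol S)) :
    Set (Trace S) :=
  {α | ∃ s, Derivation Ps ⟨IK₀ Ps, ∅⟩ α s}

/-- `e` is an event of a protocol in `Ps`, and in the context of the role specification to which
`e` belongs its instantiation is defined at `x`, with value `t`. -/
def HasValue (Ps : Set (Protocol S)) (e : RunEvent S) (x : RoleTerm S) (t : RunTerm S) : Prop :=
  ∃ P ∈ Ps, ∃ r rs, P r = some rs ∧ e.ev ∈ rs.events ∧ e.inst.apply rs x = some t

/-! ### Passing values from one protocol to another -/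

/-- `P` establishes `c`: in every trace of every system that contains `P`, the instantiation is
defined at `c` whenever a role of `P` ends. -/
def Establishes (IK₀ : Set (Protocol S) → Set (RunTerm S)) (P : Protocol S) (c : S.Ident) :
    Prop :=
  ∀ Ps, IsProtocolSet Ps → P ∈ Ps → ∀ α ∈ traces IK₀ Ps, ∀ e ∈ α, ∀ l ∈ P.labels, ∀ r,
    e.ev = .finish l r → ∃ t, HasValue {P} e (.atom (.ident c)) t

/-- Positions of the events of `α` that start a run of role `r` of a protocol in `Pin`, with role
assignment `ρ` and value `t` for the input `d`. -/
def inputPositions (Pin : Set (Protocol S)) (d : S.Ident) (α : Trace S) (r : S.Role)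
    (ρ : S.Role → Option S.Agent) (t : RunTerm S) : Set ℕ :=
  {j | ∃ e l, α[j]? = some e ∧ e.ev = .create l r ∧ e.inst.ρ = ρ ∧
    HasValue Pin e (.atom (.ident d)) t}

/-- Positions of the events of `α` that end a run of role `r` of a protocol in `Pout`, with role
assignment `ρ` and value `t` for the output `c`. -/
def outputPositions (Pout : Set (Protocol S)) (c : S.Ident) (α : Trace S) (r : S.Role)
    (ρ : S.Role → Option S.Agent) (t : RunTerm S) : Set ℕ :=
  {j | ∃ e l, α[j]? = some e ∧ e.ev = .finish l r ∧ e.inst.ρ = ρ ∧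
    HasValue Pout e (.atom (.ident c)) t}

/-- The trace restriction for unique input: runs of a role of protocols in `Pin` take their input
`d` from the output `c` of earlier runs of the same role, with the same role assignment, of
protocols in `Pout`, and every such output is used as input at most once. -/
def UniqueInput (Pout Pin : Set (Protocol S)) (c d : S.Ident) (α : Trace S) : Prop :=
  ∀ r ρ t, ∃ f : ℕ → ℕ, Set.InjOn f (inputPositions Pin d α r ρ t) ∧
    ∀ j ∈ inputPositions Pin d α r ρ t, f j ∈ outputPositions Pout c α r ρ t ∧ f j < j

/-! ### Security properties -/

/-- Given a protocol set and a claim event, a predicate on instantiations and traces. -/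
abbrev SecurityProperty (S : Signature.{u}) : Type u :=
  Set (Protocol S) → Event S → Inst S → Trace S → Prop

def sessionUnique : SecurityProperty S := fun Ps ev inst α =>
  match ev with
  | .claim l r _ (some m) =>
      ∀ (i j : ℕ) ei ej t, α[i]? = some ei → α[j]? = some ej →
        (∃ cl x, ei.ev = .claim l r cl x) → (∃ cl x, ej.ev = .claim l r cl x) →
        HasValue Ps ei m t → HasValue Ps ej m t → HasValue Ps ⟨inst, ev⟩ m t → i = j
  | _ => False

/-- `κ` (considered on the roles of `P` only) is a cast for `P` in `α`. -/
def IsCast (P : Protocol S) (α : Trace S) (κ : S.Role → S.RunId) : Prop :=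
  ∃ ρ : S.Role → Option S.Agent, ∀ r ∈ P.dom, ∃ e ∈ α, ∃ l ∈ P.labels,
    e.inst.rid = κ r ∧ e.inst.ρ = ρ ∧ e.ev = .create l r

def dataAgree : SecurityProperty S := fun Ps ev inst α =>
  match ev with
  | .claim l _ _ (some m) =>
      ∃ P ∈ Ps, l ∈ P.labels ∧ ∃ κ, IsCast P α κ ∧
        ∀ r' ∈ P.dom, ∃ e ∈ α, e.inst.rid = κ r' ∧
          ∃ t, HasValue Ps e m t ∧ HasValue Ps ⟨inst, ev⟩ m t
  | _ => False

/-- The protocol set `Ps` under the trace restriction `χ` satisfies the claim labelled `l`, which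
is a claim of name `cl` expressing the security property `f`. Only claims in sessions between
trusted agents are evaluated. -/
def Satisfies (IK₀ : Set (Protocol S) → Set (RunTerm S)) (Ps : Set (Protocol S))
    (χ : Trace S → Prop) (cl : ClaimName S) (f : SecurityProperty S) (l : S.Label) : Prop :=
  ∀ α ∈ traces IK₀ Ps, χ α → ∀ (inst : Inst S) r x, ⟨inst, .claim l r cl x⟩ ∈ α →
    f Ps (.claim l r cl x) inst α ∨ ¬ {a | ∃ r', inst.ρ r' = some a} ⊆ S.trusted

/-- A claim event with label `l`, name `cl` and an argument occurs in `P`. -/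
def Protocol.HasClaim (P : Protocol S) (cl : ClaimName S) (l : S.Label) : Prop :=
  ∃ r rs m, P r = some rs ∧ Event.claim l r cl (some m) ∈ rs.events

/-! ### Sequential and chaining composition -/

/-- Sequential composition: the last event (`finish`) of the first and the first event (`create`) of
the second specification are removed. -/
def RoleSpec.seq (rs₁ rs₂ : RoleSpec S) : RoleSpec S where
  events := rs₁.events.dropLast ++ rs₂.events.tail
  typ x := (rs₁.typ x).or (rs₂.typ x)

open Classical in
/-- Replace the identifier `d` by `c`. -/
noncomputable def RoleTerm.subst (c d : S.Ident) (x : RoleTerm S) : RoleTerm S :=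
  Term.map (fun a => if a = .ident d then .ident c else a) x

open Classical in
/-- `rs[c/d]` -/
noncomputable def RoleSpec.subst (c d : S.Ident) (rs : RoleSpec S) : RoleSpec S where
  events := rs.events.map (Event.map id (RoleTerm.subst c d))
  typ x := if x = c then rs.typ d else if x = d then none else rs.typ x

def RoleSpec.relabel (lam : S.Label → S.Label) (rs : RoleSpec S) : RoleSpec S where
  events := rs.events.map (Event.map lam id)
  typ := rs.typ

/-- The chaining composition of `P` and `Q`, in which the event that was labelled `l` in `P` or
`Q` gets the label `lam l`. -/
noncomputable def chain (lam : S.Label → S.Label) (P Q : Protocol S) (c d : S.Ident) :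
    Protocol S := fun r =>
  match P r, Q r with
  | some rs₁, some rs₂ => some ((rs₁.seq (rs₂.subst c d)).relabel lam)
  | _, _ => none

/-- The conditions under which the chaining composition of `P` and `Q` is defined. -/
structure ChainDefined (IK₀ : Set (Protocol S) → Set (RunTerm S)) (P Q : Protocol S)
    (c d : S.Ident) : Prop where
  dom_eq : P.dom = Q.dom
  idents_disjoint : Disjoint P.idents Q.idents
  establishes : Establishes IK₀ P c
  param : ∀ r rs, Q r = some rs → rs.typ d = some .param

end SecProt

open SecProt

/-! Every run of a chained role is cut in two. Let `α` be a trace of the system with `chain lam P Q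
c d`. A chained run with identifier `i` is replayed as a run of `P` with the same identifier,
followed by a run of `Q` with a fresh identifier `π i`; all other runs are replayed as themselves.
Just before the first event of the second half, the end event of `P` and the create event of `Q` are
inserted, the value of `c` becoming the input `d`. It is there because `P` establishes `c`. The
result `β` is a trace of the split system, and unique input holds since every create event of `Q`
directly follows the end event that feeds it: `f j = j - 1` works (`InputOk.uniqueInput`).

The fresh identifier only affects constants of `Q`: `x♯i` becomes `x♯(π i)`. As `P` and `Q` share no
identifiers and `π` fixes the identifiers of all other runs, this is one renaming `τ` of nonces,
applied to all run terms. It respects intruder derivations and fixes the initial knowledge, so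
whatever is read in `α` can be read, renamed, in `β` (`Derivable.rename`, `Exec.pull`,
`ChainSim.Sim.step`). A trace has finitely many runs, so a suitable injective `π` exists
(`exists_injective_avoiding`), and then `τ` is injective too.

Claims are carried back as follows. The positions of `α` embed into those of `β`
(`ChainSim.Sim.exists_embedding`), so two claim events of `α` with equal values have images with
equal values; if these are the same event, so are the originals. For data-agree, every event of `P`
or `Q` in `β` has its instantiation from an event of a chained run in `α` (`ChainSim.Source`);
injectivity of `π` and `τ` turns equal run identifiers and equal values in `β` into equal ones in
`α`. `ChainSim.Part` lets both halves share one argument. -/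

namespace SecProt

variable {F A B : Type u} {S : Signature.{u}}

/-! ### Renaming atoms -/

namespace Term

theorem map_congr {g h : A → B} (t : Term F A) (H : ∀ a ∈ t.atoms, g a = h a) :
    t.map g = t.map h := by
  induction t with
  | atom a => simp [Term.map, H a (by simp [Term.atoms])]
  | fn f args ih =>
    simp only [Term.map]
    congr 1
    funext i
    exact ih i fun a ha => H a (by simp only [Term.atoms, Set.mem_iUnion]; exact ⟨i, ha⟩)
  | pair x y ihx ihy =>
    simp only [Term.map]
    rw [ihx fun a ha => H a (Or.inl ha), ihy fun a ha => H a (Or.inr ha)]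
  | enc x y ihx ihy =>
    simp only [Term.map]
    rw [ihx fun a ha => H a (Or.inl ha), ihy fun a ha => H a (Or.inr ha)]

theorem map_id (t : Term F A) : t.map id = t := by
  induction t with
  | atom a => rfl
  | fn f args ih => simp only [Term.map]; congr 1; funext i; exact ih i
  | pair x y ihx ihy => simp only [Term.map, ihx, ihy]
  | enc x y ihx ihy => simp only [Term.map, ihx, ihy]

theorem map_injective {g : A → B} (hg : Function.Injective g) :
    Function.Injective (Term.map g : Term F A → Term F B) := by
  intro t
  induction t with
  | atom a =>
    intro t' h
    cases t' <;> simp only [Term.map, Term.atom.injEq, reduceCtorEq] at h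
    rw [hg h]
  | fn f args ih =>
    intro t' h
    cases t' <;> simp only [Term.map, Term.fn.injEq, reduceCtorEq] at h
    obtain ⟨rfl, rfl, h⟩ := h
    congr 1
    funext i
    exact ih i (congrFun (eq_of_heq h) i)
  | pair x y ihx ihy =>
    intro t' h
    cases t' <;> simp only [Term.map, Term.pair.injEq, reduceCtorEq] at h
    rw [ihx h.1, ihy h.2]
  | enc x y ihx ihy =>
    intro t' h
    cases t' <;> simp only [Term.map, Term.enc.injEq, reduceCtorEq] at h
    rw [ihx h.1, ihy h.2]

theorem mem_atoms_map {g : A → B} {t : Term F A} {b : B} :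
    b ∈ (t.map g).atoms ↔ ∃ a ∈ t.atoms, g a = b := by
  induction t with
  | atom a => simp [Term.map, Term.atoms, eq_comm]
  | fn f args ih => simp only [Term.map, Term.atoms, Set.mem_iUnion, ih]; tauto
  | pair x y ihx ihy =>
    simp only [Term.map, Term.atoms, Set.mem_union, ihx, ihy, or_and_right, exists_or]
  | enc x y ihx ihy =>
    simp only [Term.map, Term.atoms, Set.mem_union, ihx, ihy, or_and_right, exists_or]

theorem isSome_pmap {g : A → Option B} (t : Term F A) :
    (t.pmap g).isSome = true ↔ ∀ a ∈ t.atoms, (g a).isSome = true := by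
  induction t with
  | atom a => simp [Term.pmap, Term.atoms]
  | fn f args ih =>
    simp only [Term.pmap, Term.atoms, Set.mem_iUnion]
    split_ifs with h
    · simp only [Option.isSome_some, true_iff]
      rintro a ⟨i, hi⟩
      exact (ih i).1 (h i) a hi
    · simp only [Option.isSome_none, Bool.false_eq_true, false_iff]
      exact fun H => h fun i => (ih i).2 fun a ha => H a ⟨i, ha⟩
  | pair x y ihx ihy =>
    simp only [Term.atoms, Set.mem_union, or_imp, forall_and, ← ihx, ← ihy, Term.pmap]
    cases x.pmap g <;> simp
  | enc x y ihx ihy =>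
    simp only [Term.atoms, Set.mem_union, or_imp, forall_and, ← ihx, ← ihy, Term.pmap]
    cases x.pmap g <;> simp

/-- Evaluation is determined atom by atom, definedness included. Having `h` inside and `k` outside
allows identifiers to be substituted before evaluation and nonces to be renamed after it. -/
theorem pmap_map_eq {A' B' : Type u} {g : A → Option B} {h : A → A'} {g' : A' → Option B'}
    {k : B' → B} (t : Term F A) (H : ∀ a ∈ t.atoms, g a = (g' (h a)).map k) :
    t.pmap g = ((t.map h).pmap g').map (Term.map k) := by
  induction t with
  | atom a =>
    simp only [Term.map, Term.pmap, H a (by simp [Term.atoms]), Option.map_map]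
    rfl
  | fn f args ih =>
    have ih' : ∀ i, (args i).pmap g = (((args i).map h).pmap g').map (Term.map k) := fun i =>
      ih i fun a ha => H a (by simp only [Term.atoms, Set.mem_iUnion]; exact ⟨i, ha⟩)
    simp only [Term.map, Term.pmap, ih', Option.isSome_map]
    split_ifs with hs
    · simp only [Option.map_some, Term.map, Option.get_map]
    · rfl
  | pair x y ihx ihy =>
    simp only [Term.map, Term.pmap]
    rw [ihx fun a ha => H a (Or.inl ha), ihy fun a ha => H a (Or.inr ha)]
    cases (x.map h).pmap g' <;> cases (y.map h).pmap g' <;> rfl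
  | enc x y ihx ihy =>
    simp only [Term.map, Term.pmap]
    rw [ihx fun a ha => H a (Or.inl ha), ihy fun a ha => H a (Or.inr ha)]
    cases (x.map h).pmap g' <;> cases (y.map h).pmap g' <;> rfl

end Term

theorem Event.map_id_id (e : Event S) : e.map id id = e := by
  cases e <;> simp [Event.map]

theorem Event.label_map (f : S.Label → S.Label) (g : RoleTerm S → RoleTerm S) (e : Event S) :
    (e.map f g).label = f e.label := by
  cases e <;> rfl

/-- Replacement of identifiers in the atoms of role terms. -/
def RoleAtom.mapIdent (g : S.Ident → S.Ident) : RoleAtom S → RoleAtom S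
  | .ident x => .ident (g x)
  | .role r => .role r

theorem RoleAtom.mapIdent_id : RoleAtom.mapIdent (id : S.Ident → S.Ident) = id := by
  funext a; cases a <;> rfl

/-- Replacement of identifiers in role terms. -/
def RoleTerm.rename (g : S.Ident → S.Ident) : RoleTerm S → RoleTerm S :=
  Term.map (RoleAtom.mapIdent g)

theorem RoleTerm.rename_id : (RoleTerm.rename id : RoleTerm S → RoleTerm S) = id := by
  funext t
  rw [RoleTerm.rename, RoleAtom.mapIdent_id, Term.map_id, id]

/-- Replacement of nonces in the atoms of run terms. -/
def RunAtom.mapNonce (τ : Nonce S → Nonce S) : RunAtom S → RunAtom S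
  | .agent a => .agent a
  | .nonce n => .nonce (τ n)

theorem RunAtom.mapNonce_injective {τ : Nonce S → Nonce S} (h : Function.Injective τ) :
    Function.Injective (RunAtom.mapNonce τ) := by
  intro a b hab
  cases a <;> cases b <;> simp_all [RunAtom.mapNonce]
  exact h hab

/-- Replacement of nonces in run terms. -/
def RunTerm.rename (τ : Nonce S → Nonce S) : RunTerm S → RunTerm S :=
  Term.map (RunAtom.mapNonce τ)

theorem RunTerm.rename_injective {τ : Nonce S → Nonce S} (h : Function.Injective τ) :
    Function.Injective (RunTerm.rename τ) :=
  Term.map_injective (RunAtom.mapNonce_injective h)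

theorem RunTerm.rename_invKey (τ : Nonce S → Nonce S) (t : RunTerm S) :
    RunTerm.rename τ (invKey t) = invKey (RunTerm.rename τ t) := by
  cases t <;> rfl

/-- Renaming acts only on atoms and `invKey` only on a function symbol at the head, so they commute
and every derivation rule survives. Injectivity of `τ` plays no role here. -/
theorem Derivable.rename {τ : Nonce S → Nonce S} {K L : Set (RunTerm S)}
    (h : ∀ t ∈ K, RunTerm.rename τ t ∈ L) {t : RunTerm S} (ht : Derivable K t) :
    Derivable L (RunTerm.rename τ t) := by
  induction ht with
  | base h' => exact .base (h _ h')
  | pair _ _ ih₁ ih₂ => exact .pair ih₁ ih₂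
  | left _ ih => exact .left ih
  | right _ ih => exact .right ih
  | encrypt _ _ ih₁ ih₂ => exact .encrypt ih₁ ih₂
  | decrypt _ _ ih₁ ih₂ => exact .decrypt ih₁ (RunTerm.rename_invKey τ _ ▸ ih₂)

/-! ### Transfer of instantiations -/

/-- The value of an identifier. -/
def Inst.value (inst : Inst S) (typ : S.Ident → Option IdType) (x : S.Ident) :
    Option (Nonce S) :=
  match typ x with
  | some .const => some (.run x inst.rid)
  | some .param => inst.σ x
  | some .var => inst.σ x
  | none => none

theorem Inst.atomValue_ident (inst : Inst S) (typ : S.Ident → Option IdType) (x : S.Ident) :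
    inst.atomValue typ (.ident x) = (inst.value typ x).map .nonce := by
  simp only [Inst.atomValue, Inst.value]
  rcases typ x with _ | _ | _ | _ <;> rfl

theorem Inst.apply_ident (inst : Inst S) (rs : RoleSpec S) (x : S.Ident) :
    inst.apply rs (.atom (.ident x)) = (inst.value rs.typ x).map fun n => .atom (.nonce n) := by
  simp only [Inst.apply, Term.pmap, Inst.atomValue_ident, Option.map_map]
  rfl

theorem Inst.isSome_typ_of_value {inst : Inst S} {typ : S.Ident → Option IdType} {x : S.Ident}
    (h : (inst.value typ x).isSome = true) : (typ x).isSome = true := by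
  unfold Inst.value at h
  split at h <;> simp_all

theorem Matches.value_eq {rs : RoleSpec S} {inst inst' : Inst S} {m : RoleTerm S}
    {t : RunTerm S} (h : Matches rs inst m t inst') {x : S.Ident} {v : Nonce S}
    (hv : inst.value rs.typ x = some v) : inst'.value rs.typ x = some v := by
  obtain ⟨h1, -, h3, -, -⟩ := h
  unfold Inst.value at hv ⊢
  split at hv <;> simp_all

theorem Matches.isSome_value {rs : RoleSpec S} {inst inst' : Inst S} {m : RoleTerm S}
    {t : RunTerm S} (h : Matches rs inst m t inst') (x : S.Ident) :
    (inst'.value rs.typ x).isSome = true ↔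
      (inst.value rs.typ x).isSome = true ∨ x ∈ rs.varsIn m := by
  obtain ⟨-, -, -, h4, -⟩ := h
  have := h4 x
  unfold Inst.value
  split
  · simp
  · exact this
  · exact this
  · simp_all [RoleSpec.varsIn]

/-- The instantiation for the typing `typB` in which `x` has the value that `g x` has under `inst`
for the typing `typA`, with nonces replaced along `τ` and the run identifier along `p`. -/
def Inst.pull (typA typB : S.Ident → Option IdType) (g : S.Ident → S.Ident)
    (τ : Nonce S → Nonce S) (p : S.RunId → S.RunId) (inst : Inst S) : Inst S where
  rid := p inst.rid
  ρ := inst.ρ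
  σ x :=
    match typB x with
    | some .param => (inst.value typA (g x)).map τ
    | some .var => (inst.value typA (g x)).map τ
    | _ => none

/-- Constants are transferred to constants. -/
def ConstCompat (typA typB : S.Ident → Option IdType) (g : S.Ident → S.Ident)
    (τ : Nonce S → Nonce S) (p : S.RunId → S.RunId) (rid : S.RunId) : Prop :=
  ∀ x, typB x = some .const →
    typA (g x) = some .const ∧ τ (.run (g x) rid) = .run x (p rid)

/-- Every parameter or variable of `typB` either stands for an identifier with a value or has the
same type in `typA` and stands for an identifier for which no other identifier stands. -/
def FlexCompat (typA typB : S.Ident → Option IdType) (g : S.Ident → S.Ident) (inst : Inst S) :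
    Prop :=
  ∀ x, typB x = some .param ∨ typB x = some .var →
    (inst.value typA (g x)).isSome = true ∨
      (typA (g x) = typB x ∧ ∀ y, (typB y).isSome = true → g y = g x → y = x)

section Pull

variable {rsA rsB : RoleSpec S} {g : S.Ident → S.Ident} {τ : Nonce S → Nonce S}
  {p : S.RunId → S.RunId} {inst inst' : Inst S}

theorem Inst.value_pull (hc : ConstCompat rsA.typ rsB.typ g τ p inst.rid) {x : S.Ident}
    (hx : (rsB.typ x).isSome = true) :
    (inst.pull rsA.typ rsB.typ g τ p).value rsB.typ x = (inst.value rsA.typ (g x)).map τ := by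
  rw [Inst.value]
  split
  · next h =>
    obtain ⟨h1, h2⟩ := hc x h
    simp [Inst.value, h1, h2, Inst.pull]
  · next h => simp [Inst.pull, h]
  · next h => simp [Inst.pull, h]
  · next h => simp [h] at hx

theorem Inst.apply_pull (hc : ConstCompat rsA.typ rsB.typ g τ p inst.rid) {m : RoleTerm S}
    (hm : ∀ x, RoleAtom.ident x ∈ m.atoms → (rsB.typ x).isSome = true) :
    (inst.pull rsA.typ rsB.typ g τ p).apply rsB m =
      (inst.apply rsA (RoleTerm.rename g m)).map (RunTerm.rename τ) := by
  refine Term.pmap_map_eq m fun a ha => ?_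
  cases a with
  | role r =>
    simp only [Inst.atomValue, RoleAtom.mapIdent, Inst.pull, Option.map_map]
    rfl
  | ident x =>
    simp only [RoleAtom.mapIdent, Inst.atomValue_ident, Inst.value_pull hc (hm x ha),
      Option.map_map]
    rfl

/-- A defined value already forces all identifiers of `m` to be typed, so no typing assumption is
needed. This is the direction that brings values of simulated runs back to `α`. -/
theorem Inst.exists_apply_of_pull (hc : ConstCompat rsA.typ rsB.typ g τ p inst.rid)
    {m : RoleTerm S} {t' : RunTerm S}
    (h : (inst.pull rsA.typ rsB.typ g τ p).apply rsB m = some t') :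
    ∃ t, inst.apply rsA (RoleTerm.rename g m) = some t ∧ RunTerm.rename τ t = t' := by
  rw [Inst.apply_pull hc] at h
  · simpa using h
  · intro x hx
    have := (Term.isSome_pmap m).1 (by rw [Inst.apply] at h; rw [h]; rfl) _ hx
    rw [Inst.atomValue_ident, Option.isSome_map] at this
    exact Inst.isSome_typ_of_value this

/-- The delicate point is that a match must bind exactly the variables of the pattern, on both
sides; `FlexCompat` is what makes the two sets of bound identifiers agree. -/
theorem Matches.pull (hc : ConstCompat rsA.typ rsB.typ g τ p inst.rid)
    (hf : FlexCompat rsA.typ rsB.typ g inst) {m : RoleTerm S}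
    (hm : ∀ x, RoleAtom.ident x ∈ m.atoms → (rsB.typ x).isSome = true) {t : RunTerm S}
    (h : Matches rsA inst (RoleTerm.rename g m) t inst') :
    Matches rsB (inst.pull rsA.typ rsB.typ g τ p) m (RunTerm.rename τ t)
      (inst'.pull rsA.typ rsB.typ g τ p) := by
  refine ⟨congrArg p h.1, h.2.1, fun x v hv => ?_, fun x => ?_, ?_⟩
  · simp only [Inst.pull] at hv ⊢
    split at hv
    · obtain ⟨w, hw, rfl⟩ := Option.map_eq_some_iff.1 hv
      rw [h.value_eq hw]; rfl
    · obtain ⟨w, hw, rfl⟩ := Option.map_eq_some_iff.1 hv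
      rw [h.value_eq hw]; rfl
    · cases hv
  · have key : rsB.typ x = some .param ∨ rsB.typ x = some .var →
        ((inst'.value rsA.typ (g x)).isSome = true ↔
          (inst.value rsA.typ (g x)).isSome = true ∨ x ∈ rsB.varsIn m) := by
      intro hx
      rw [h.isSome_value]
      -- Either `g x` had a value before the match, so nothing depends on the pattern, or `x` is the
      -- only identifier sent to `g x`, so that it occurs in `m` exactly if `g x` occurs in the
      -- renamed pattern.
      rcases hf x hx with h' | ⟨h1, h2⟩
      · simp [h']
      · refine or_congr_right ?_
        simp only [RoleSpec.varsIn, Set.mem_ofPred_eq, h1, and_congr_left_iff]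
        rintro -
        rw [RoleTerm.rename, Term.mem_atoms_map]
        constructor
        · rintro ⟨a, ha, hax⟩
          cases a with
          | role r => simp [RoleAtom.mapIdent] at hax
          | ident y =>
            simp only [RoleAtom.mapIdent, RoleAtom.ident.injEq] at hax
            rwa [← h2 y (hm y ha) hax]
        · exact fun hx => ⟨_, hx, rfl⟩
    simp only [Inst.pull]
    split
    · next hx => rw [Option.isSome_map, Option.isSome_map]; exact key (Or.inl hx)
    · next hx => rw [Option.isSome_map, Option.isSome_map]; exact key (Or.inr hx)
    · next h1 h2 => simpa [RoleSpec.varsIn] using fun _ => h2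
  · have hc' : ConstCompat rsA.typ rsB.typ g τ p inst'.rid := h.1 ▸ hc
    rw [Inst.apply_pull hc' hm, h.2.2.2.2]
    rfl

end Pull

/-! ### Execution of a single event -/

/-- A run of `rs` with instantiation `inst` executes its next event, after which `rest` remains;
intruder knowledge and instantiation are updated to `K'` and `inst'`. -/
def Exec (K : Set (RunTerm S)) (rs : RoleSpec S) (inst : Inst S) (ev : Event S)
    (rest : List (Event S)) (inst' : Inst S) (K' : Set (RunTerm S)) : Prop :=
  match ev with
  | .create _ _ => False
  | .send _ _ _ m => inst' = inst ∧ ∃ t, inst.apply rs m = some t ∧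
      K' = knowledgeClosure (insert t K)
  | .read _ _ _ m => K' = K ∧ ∃ t ∈ K, Matches rs inst m t inst'
  | .claim _ _ _ _ => inst' = inst ∧ K' = K
  | .finish _ _ => inst' = inst ∧ K' = K ∧ rest = []

section Exec

variable {K K' : Set (RunTerm S)} {rs : RoleSpec S} {inst inst' : Inst S} {ev : Event S}
  {rest : List (Event S)}

theorem Exec.step {Ps : Set (Protocol S)} {R : Set (Run S)}
    (h : Exec K rs inst ev rest inst' K') (hR : ⟨rs, inst, ev :: rest⟩ ∈ R) :
    Step Ps ⟨K, R⟩ ⟨inst', ev⟩ ⟨K', replaceRun R ⟨rs, inst, ev :: rest⟩ ⟨rs, inst', rest⟩⟩ := by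
  cases ev with
  | create l r => exact h.elim
  | send l a b m => obtain ⟨rfl, t, ht, rfl⟩ := h; exact .send hR ht
  | read l a b m => obtain ⟨rfl, t, ht, hm⟩ := h; exact .read hR ht hm
  | claim l r cl x => obtain ⟨rfl, rfl⟩ := h; exact .claim hR
  | finish l r => obtain ⟨rfl, rfl, rfl⟩ := h; exact .finish hR

/-- Creation is the only rule that depends on the protocol set. The other four are uniform in
`Exec`, which lets the simulation treat them together. -/
theorem Step.cases_exec {Ps : Set (Protocol S)} {s s' : State S} {e : RunEvent S}
    (h : Step Ps s e s') :
    (∃ P ∈ Ps, ∃ r rs l rest, P r = some rs ∧ rs.events = .create l r :: rest ∧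
      e.ev = .create l r ∧ IsInitial P rs e.inst ∧ (∀ run ∈ s.runs, run.inst.rid ≠ e.inst.rid) ∧
      s' = ⟨s.know, insert ⟨rs, e.inst, rest⟩ s.runs⟩) ∨
    (∃ rs inst rest, ⟨rs, inst, e.ev :: rest⟩ ∈ s.runs ∧
      Exec s.know rs inst e.ev rest e.inst s'.know ∧
      s'.runs = replaceRun s.runs ⟨rs, inst, e.ev :: rest⟩ ⟨rs, e.inst, rest⟩) := by
  cases h with
  | create hP hr he hi hf =>
    exact Or.inl ⟨_, hP, _, _, _, _, hr, he, rfl, hi, hf, rfl⟩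
  | finish hR => exact Or.inr ⟨_, _, _, hR, ⟨rfl, rfl, rfl⟩, rfl⟩
  | send hR ht => exact Or.inr ⟨_, _, _, hR, ⟨rfl, _, ht, rfl⟩, rfl⟩
  | read hR ht hm => exact Or.inr ⟨_, _, _, hR, ⟨rfl, _, ht, hm⟩, rfl⟩
  | claim hR => exact Or.inr ⟨_, _, _, hR, ⟨rfl, rfl⟩, rfl⟩

theorem Exec.rid_eq (h : Exec K rs inst ev rest inst' K') : inst'.rid = inst.rid := by
  cases ev with
  | create l r => exact h.elim
  | send l a b m => rw [h.1]
  | read l a b m => obtain ⟨-, t, -, hm⟩ := h; exact hm.1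
  | claim l r cl x => rw [h.1]
  | finish l r => rw [h.1]

theorem Exec.ρ_eq (h : Exec K rs inst ev rest inst' K') : inst'.ρ = inst.ρ := by
  cases ev with
  | create l r => exact h.elim
  | send l a b m => rw [h.1]
  | read l a b m => obtain ⟨-, t, -, hm⟩ := h; exact hm.2.1
  | claim l r cl x => rw [h.1]
  | finish l r => rw [h.1]

theorem Exec.isSome_value (h : Exec K rs inst ev rest inst' K') {x : S.Ident}
    (hx : (inst.value rs.typ x).isSome = true) : (inst'.value rs.typ x).isSome = true := by
  cases ev with
  | create l r => exact h.elim
  | send l a b m => rwa [h.1]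
  | read l a b m => obtain ⟨-, t, -, hm⟩ := h; exact (hm.isSome_value x).2 (Or.inl hx)
  | claim l r cl x => rwa [h.1]
  | finish l r => rwa [h.1]

theorem Exec.isSome_σ (h : Exec K rs inst ev rest inst' K') {x : S.Ident}
    (hx : x ∉ ev.idents) : (inst'.σ x).isSome = true ↔ (inst.σ x).isSome = true := by
  cases ev with
  | create l r => exact h.elim
  | send l a b m => rw [h.1]
  | read l a b m =>
    obtain ⟨-, t, -, hm⟩ := h
    rw [hm.2.2.2.1 x, or_iff_left]
    exact fun hv => hx hv.1
  | claim l r cl x => rw [h.1]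
  | finish l r => rw [h.1]

theorem Exec.not_create (h : Exec K rs inst ev rest inst' K') (l : S.Label) (r : S.Role) :
    ev ≠ .create l r := by
  rintro rfl; exact h

/-- One event of the simulation. A send enlarges both knowledge sets in parallel, and a read finds
the renamed message by `hK`. `hrest` serves only the end event, which must be the last one on both
sides. -/
theorem Exec.pull {KB : Set (RunTerm S)} {rsB : RoleSpec S} {g : S.Ident → S.Ident}
    {τ : Nonce S → Nonce S} {p : S.RunId → S.RunId} {f : S.Label → S.Label}
    {restB : List (Event S)} (hc : ConstCompat rs.typ rsB.typ g τ p inst.rid)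
    (hf : FlexCompat rs.typ rsB.typ g inst) (hev : ∀ x ∈ ev.idents, (rsB.typ x).isSome = true)
    (hK : ∀ t ∈ K, RunTerm.rename τ t ∈ KB) (hrest : rest = [] → restB = [])
    (h : Exec K rs inst (ev.map f (RoleTerm.rename g)) rest inst' K') :
    ∃ KB', Exec KB rsB (inst.pull rs.typ rsB.typ g τ p) ev restB
        (inst'.pull rs.typ rsB.typ g τ p) KB' ∧ ∀ t ∈ K', RunTerm.rename τ t ∈ KB' := by
  cases ev with
  | create l r => exact h.elim
  | send l a b m =>
    obtain ⟨rfl, t, ht, rfl⟩ := h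
    refine ⟨_, ⟨rfl, RunTerm.rename τ t, ?_, rfl⟩, fun t' ht' => Derivable.rename ?_ ht'⟩
    · rw [Inst.apply_pull hc hev, ht]; rfl
    · rintro t'' (rfl | h'')
      · exact Or.inl rfl
      · exact Or.inr (hK _ h'')
  | read l a b m =>
    obtain ⟨rfl, t, ht, hm⟩ := h
    exact ⟨KB, ⟨rfl, _, hK t ht, hm.pull hc hf hev⟩, hK⟩
  | claim l r cl x =>
    obtain ⟨rfl, rfl⟩ := h
    exact ⟨KB, ⟨rfl, rfl⟩, hK⟩
  | finish l r =>
    obtain ⟨rfl, rfl, h⟩ := h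
    exact ⟨KB, ⟨rfl, rfl, hrest h⟩, hK⟩

end Exec

/-! ### Derivations -/

theorem Derivation.snoc {Ps : Set (Protocol S)} {s s' s'' : State S} {α : Trace S}
    {e : RunEvent S} (h : Derivation Ps s α s') (h' : Step Ps s' e s'') :
    Derivation Ps s (α ++ [e]) s'' := by
  induction h with
  | nil s => exact .cons h' (.nil _)
  | cons h₁ _ ih => exact .cons h₁ (ih h')

theorem mem_replaceRun {R : Set (Run S)} {run run' run'' : Run S} :
    run'' ∈ replaceRun R run run' ↔ run'' = run' ∨ (run'' ∈ R ∧ run'' ≠ run) := by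
  simp [replaceRun]

/-- What is known about the runs and events when the trace `α` has led to the state `s`. -/
structure Reached (Ps : Set (Protocol S)) (α : Trace S) (s : State S) : Prop where
  finite : s.runs.Finite
  eq_of_rid : ∀ run ∈ s.runs, ∀ run' ∈ s.runs, run.inst.rid = run'.inst.rid → run = run'
  created : ∀ run ∈ s.runs, ∃ P ∈ Ps, ∃ r, P r = some run.spec ∧ ∃ e ∈ α, ∃ l,
    e.ev = .create l r ∧ e.ev ∈ run.spec.events ∧ e.inst.rid = run.inst.rid ∧
      e.inst.ρ = run.inst.ρ
  suffix : ∀ run ∈ s.runs, run.rest <:+ run.spec.events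
  last : ∀ run ∈ s.runs, ∃ e ∈ α, e.inst = run.inst ∧ e.ev ∈ run.spec.events
  owner : ∀ e ∈ α, ∃ run ∈ s.runs, run.inst.rid = e.inst.rid ∧ run.inst.ρ = e.inst.ρ ∧
    e.ev ∈ run.spec.events

theorem Reached.init (Ps : Set (Protocol S)) (K : Set (RunTerm S)) :
    Reached Ps [] ⟨K, ∅⟩ := by
  constructor <;> simp

/-- The second conjunct says that runs persist with their identifier and specification, so facts
about the runs of a final state apply to all earlier ones. -/
theorem Reached.step {Ps : Set (Protocol S)} {α : Trace S} {s s' : State S} {e : RunEvent S}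
    (h : Reached Ps α s) (hs : Step Ps s e s') :
    Reached Ps (α ++ [e]) s' ∧ ∀ run ∈ s.runs, ∃ run' ∈ s'.runs,
      run'.inst.rid = run.inst.rid ∧ run'.spec = run.spec := by
  have hmono : ∀ {p : RunEvent S → Prop}, (∃ e ∈ α, p e) → ∃ e' ∈ α ++ [e], p e' :=
    fun ⟨e', h1, h2⟩ => ⟨e', List.mem_append_left _ h1, h2⟩
  have hmem : e ∈ α ++ [e] := by simp
  rcases hs.cases_exec with ⟨P, hP, r, rs, l, rest, hr, he, hev, hi, hfresh, rfl⟩ |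
    ⟨rs, inst, rest, hR, hex, hs'⟩
  · refine ⟨⟨h.finite.insert _, ?_, ?_, ?_, ?_, ?_⟩, fun run hrun => ⟨run, Or.inr hrun, rfl, rfl⟩⟩
    · rintro run (rfl | hrun) run' (rfl | hrun') hrid
      · rfl
      · exact (hfresh _ hrun' hrid.symm).elim
      · exact (hfresh _ hrun hrid).elim
      · exact h.eq_of_rid _ hrun _ hrun' hrid
    · rintro run (rfl | hrun)
      · exact ⟨P, hP, r, hr, e, hmem, l, hev, by simp [hev, he], rfl, rfl⟩
      · obtain ⟨P', hP', r', hr', h'⟩ := h.created run hrun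
        exact ⟨P', hP', r', hr', hmono h'⟩
    · rintro run (rfl | hrun)
      · exact ⟨[.create l r], by simp [he]⟩
      · exact h.suffix run hrun
    · rintro run (rfl | hrun)
      · exact ⟨e, hmem, rfl, by simp [hev, he]⟩
      · exact hmono (h.last run hrun)
    · intro e' he'
      rcases List.mem_append.1 he' with he' | he'
      · obtain ⟨run, hrun, h'⟩ := h.owner e' he'
        exact ⟨run, Or.inr hrun, h'⟩
      · obtain rfl := List.mem_singleton.1 he'
        exact ⟨_, Or.inl rfl, rfl, rfl, by simp [hev, he]⟩
  · have hsuf := h.suffix _ hR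
    have hin : e.ev ∈ rs.events := hsuf.subset (by simp)
    have hkeep : ∀ run ∈ s.runs, ∃ run' ∈ s'.runs, run'.inst.rid = run.inst.rid ∧
        run'.inst.ρ = run.inst.ρ ∧ run'.spec = run.spec := by
      intro run hrun
      by_cases heq : run = ⟨rs, inst, e.ev :: rest⟩
      · subst heq
        exact ⟨⟨rs, e.inst, rest⟩, by rw [hs']; exact mem_replaceRun.2 (Or.inl rfl),
          hex.rid_eq, hex.ρ_eq, rfl⟩
      · exact ⟨run, by rw [hs']; exact mem_replaceRun.2 (Or.inr ⟨hrun, heq⟩), rfl, rfl, rfl⟩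
    refine ⟨⟨?_, ?_, ?_, ?_, ?_, ?_⟩, fun run hrun => ?_⟩
    · rw [hs']; exact (h.finite.sdiff).insert _
    · have key : ∀ run ∈ s.runs, run.inst.rid = e.inst.rid → run = ⟨rs, inst, e.ev :: rest⟩ :=
        fun run hrun hrid => h.eq_of_rid _ hrun _ hR (hrid.trans hex.rid_eq)
      intro run hrun run' hrun' hrid
      rw [hs', mem_replaceRun] at hrun hrun'
      rcases hrun with rfl | ⟨hrun, hne⟩ <;> rcases hrun' with rfl | ⟨hrun', hne'⟩
      · rfl
      · exact (hne' (key _ hrun' hrid.symm)).elim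
      · exact (hne (key _ hrun hrid)).elim
      · exact h.eq_of_rid _ hrun _ hrun' hrid
    · intro run hrun
      rw [hs', mem_replaceRun] at hrun
      rcases hrun with rfl | ⟨hrun, -⟩
      · obtain ⟨P', hP', r', hr', h'⟩ := h.created _ hR
        refine ⟨P', hP', r', hr', ?_⟩
        simp only [hex.rid_eq, hex.ρ_eq]
        exact hmono h'
      · obtain ⟨P', hP', r', hr', h'⟩ := h.created run hrun
        exact ⟨P', hP', r', hr', hmono h'⟩
    · intro run hrun
      rw [hs', mem_replaceRun] at hrun
      rcases hrun with rfl | ⟨hrun, -⟩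
      · exact (List.suffix_cons _ _).trans hsuf
      · exact h.suffix run hrun
    · intro run hrun
      rw [hs', mem_replaceRun] at hrun
      rcases hrun with rfl | ⟨hrun, -⟩
      · exact ⟨e, hmem, rfl, hin⟩
      · exact hmono (h.last run hrun)
    · intro e' he'
      rcases List.mem_append.1 he' with he' | he'
      · obtain ⟨run, hrun, h1, h2, h3⟩ := h.owner e' he'
        obtain ⟨run', hrun', h1', h2', h3'⟩ := hkeep run hrun
        exact ⟨run', hrun', h1'.trans h1, h2'.trans h2, h3' ▸ h3⟩
      · obtain rfl := List.mem_singleton.1 he'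
        exact ⟨⟨rs, e'.inst, rest⟩, by rw [hs']; exact mem_replaceRun.2 (Or.inl rfl), rfl, rfl,
          hin⟩
    · obtain ⟨run', hrun', h1, -, h2⟩ := hkeep run hrun
      exact ⟨run', hrun', h1, h2⟩

theorem Reached.derivation {Ps : Set (Protocol S)} {α β : Trace S} {s s' : State S}
    (h : Reached Ps α s) (hd : Derivation Ps s β s') :
    Reached Ps (α ++ β) s' ∧ ∀ run ∈ s.runs, ∃ run' ∈ s'.runs,
      run'.inst.rid = run.inst.rid ∧ run'.spec = run.spec := by
  induction hd generalizing α with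
  | nil s => exact ⟨by simpa using h, fun run hrun => ⟨run, hrun, rfl, rfl⟩⟩
  | cons hs _ ih =>
    obtain ⟨h1, h2⟩ := h.step hs
    obtain ⟨h3, h4⟩ := ih h1
    refine ⟨by simpa using h3, fun run hrun => ?_⟩
    obtain ⟨run', hrun', ha, hb⟩ := h2 run hrun
    obtain ⟨run'', hrun'', ha', hb'⟩ := h4 run' hrun'
    exact ⟨run'', hrun'', ha'.trans ha, hb'.trans hb⟩

/-! ### Events of protocol sets -/

/-- Labels are disjoint between protocols and unique within one, except for a send and its read; a
single event cannot be both. Hence `HasValue` does not depend on the specification chosen in it. -/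
theorem IsProtocolSet.spec_unique {Ps : Set (Protocol S)} (h : IsProtocolSet Ps)
    {P₁ P₂ : Protocol S} (h₁ : P₁ ∈ Ps) (h₂ : P₂ ∈ Ps) {r₁ r₂ : S.Role} {rs₁ rs₂ : RoleSpec S}
    (hr₁ : P₁ r₁ = some rs₁) (hr₂ : P₂ r₂ = some rs₂) {e : Event S} (he₁ : e ∈ rs₁.events)
    (he₂ : e ∈ rs₂.events) : P₁ = P₂ ∧ r₁ = r₂ ∧ rs₁ = rs₂ := by
  have hP : P₁ = P₂ := by
    by_contra hne
    exact Set.disjoint_left.1 (h.2 _ h₁ _ h₂ hne) ⟨r₁, rs₁, hr₁, e, he₁, rfl⟩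
      ⟨r₂, rs₂, hr₂, e, he₂, rfl⟩
  subst hP
  obtain ⟨i₁, hi₁⟩ := List.mem_iff_getElem?.1 he₁
  obtain ⟨i₂, hi₂⟩ := List.mem_iff_getElem?.1 he₂
  have hr : r₁ = r₂ := by
    rcases (h.1 _ h₁).2 _ _ _ _ _ _ _ _ hr₁ hi₁ hr₂ hi₂ rfl with h' | h' | h'
    · exact h'.1
    all_goals
      obtain ⟨l, a, b, x, y, hx, hy⟩ := h'
      rw [hx] at hy
      cases hy
  subst hr
  exact ⟨rfl, rfl, Option.some.inj (hr₁.symm.trans hr₂)⟩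

/-- Claim events are determined by their labels. -/
theorem Protocol.WellFormed.eq_of_label_claim {P : Protocol S} (h : P.WellFormed)
    {r₁ r₂ : S.Role} {rs₁ rs₂ : RoleSpec S} (hr₁ : P r₁ = some rs₁) (hr₂ : P r₂ = some rs₂)
    {e : Event S} {l : S.Label} {r : S.Role} {cl : ClaimName S} {x : Option (RoleTerm S)}
    (he₁ : e ∈ rs₁.events) (he₂ : .claim l r cl x ∈ rs₂.events) (hl : e.label = l) :
    r₁ = r₂ ∧ e = .claim l r cl x := by
  obtain ⟨i₁, hi₁⟩ := List.mem_iff_getElem?.1 he₁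
  obtain ⟨i₂, hi₂⟩ := List.mem_iff_getElem?.1 he₂
  rcases h.2 _ _ _ _ _ _ _ _ hr₁ hi₁ hr₂ hi₂ hl with ⟨rfl, rfl⟩ | h' | h'
  · obtain rfl := Option.some.inj (hr₁.symm.trans hr₂)
    exact ⟨rfl, Option.some.inj (hi₁.symm.trans hi₂)⟩
  · obtain ⟨l, a, b, x, y, hx, hy⟩ := h'
    cases hy
  · obtain ⟨l, a, b, x, y, hx, hy⟩ := h'
    cases hx

theorem HasValue.apply {Ps : Set (Protocol S)} (h : IsProtocolSet Ps) {P : Protocol S}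
    (hP : P ∈ Ps) {r : S.Role} {rs : RoleSpec S} (hr : P r = some rs) {e : RunEvent S}
    (he : e.ev ∈ rs.events) {x : RoleTerm S} {t : RunTerm S} (hv : HasValue Ps e x t) :
    e.inst.apply rs x = some t := by
  obtain ⟨P', hP', r', rs', hr', he', hv⟩ := hv
  obtain ⟨-, -, rfl⟩ := h.spec_unique hP hP' hr hr' he he'
  exact hv

/-! ### The simulation of chained runs by pairs of runs -/

open Classical in
/-- The replacement of `d` by `c`. -/
noncomputable def identSubst (c d : S.Ident) (x : S.Ident) : S.Ident := if x = d then c else x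

theorem identSubst_self (c d : S.Ident) : identSubst c d d = c := if_pos rfl

theorem identSubst_of_ne (c : S.Ident) {d x : S.Ident} (h : x ≠ d) : identSubst c d x = x :=
  if_neg h

theorem RoleTerm.subst_eq_rename (c d : S.Ident) :
    RoleTerm.subst c d = RoleTerm.rename (identSubst c d) := by
  funext t
  refine Term.map_congr t fun a _ => ?_
  cases a with
  | role r => simp [RoleAtom.mapIdent]
  | ident x => by_cases hx : x = d <;> simp [RoleAtom.mapIdent, identSubst, hx]

/-- The specification of a role in the chaining composition. -/
noncomputable def chainSpec (lam : S.Label → S.Label) (c d : S.Ident) (rsP rsQ : RoleSpec S) :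
    RoleSpec S :=
  (rsP.seq (rsQ.subst c d)).relabel lam

theorem chainSpec_events (lam : S.Label → S.Label) (c d : S.Ident) {rsP : RoleSpec S}
    (rsQ : RoleSpec S) {s : List (Event S)} {e : Event S} (h : rsP.events = s ++ [e]) :
    (chainSpec lam c d rsP rsQ).events = s.map (Event.map lam (RoleTerm.rename id)) ++
      rsQ.events.tail.map (Event.map lam (RoleTerm.rename (identSubst c d))) := by
  simp only [chainSpec, RoleSpec.relabel, RoleSpec.seq, h, List.dropLast_concat,
    RoleSpec.subst, List.map_append, RoleTerm.rename_id, ← RoleTerm.subst_eq_rename,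
    List.map_tail, List.map_map]
  congr 3
  funext ev
  cases ev <;> simp [Event.map]

theorem chainSpec_typ_left {lam : S.Label → S.Label} {c d : S.Ident} {rsP : RoleSpec S}
    (rsQ : RoleSpec S) {x : S.Ident} (h : (rsP.typ x).isSome = true) :
    (chainSpec lam c d rsP rsQ).typ x = rsP.typ x := by
  obtain ⟨ty, hty⟩ := Option.isSome_iff_exists.1 h
  simp [chainSpec, RoleSpec.relabel, RoleSpec.seq, hty]

theorem chainSpec_typ_right {lam : S.Label → S.Label} {c d : S.Ident} {rsP rsQ : RoleSpec S}
    {x : S.Ident} (h : rsP.typ x = none) (hc : x ≠ c) (hd : x ≠ d) :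
    (chainSpec lam c d rsP rsQ).typ x = rsQ.typ x := by
  simp [chainSpec, RoleSpec.relabel, RoleSpec.seq, h, RoleSpec.subst, hc, hd]

theorem chain_eq_some {lam : S.Label → S.Label} {P Q : Protocol S} {c d : S.Ident}
    {r : S.Role} {rs : RoleSpec S} :
    chain lam P Q c d r = some rs ↔
      ∃ rsP rsQ, P r = some rsP ∧ Q r = some rsQ ∧ rs = chainSpec lam c d rsP rsQ := by
  unfold chain
  split
  · next h1 h2 => simp [h1, h2, chainSpec, eq_comm]
  · next h =>
    simp only [reduceCtorEq, false_iff, not_exists, not_and]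
    exact fun rsP rsQ h1 h2 => (h _ _ h1 h2).elim

/-- The protocols to be chained, and a choice of run identifiers for the runs of the second
protocol: `first` are the run identifiers of the runs of the chaining composition, `others` those
of all other runs, and `π` gives new run identifiers to the former. -/
structure ChainSim (S : Signature.{u}) where
  IK₀ : Set (Protocol S) → Set (RunTerm S)
  P : Protocol S
  Q : Protocol S
  Γ : Set (Protocol S)
  c : S.Ident
  d : S.Ident
  lam : S.Label → S.Label
  defined : ChainDefined IK₀ P Q c d
  notMemP : P ∉ Γ
  notMemQ : Q ∉ Γ
  split : IsProtocolSet ({P, Q} ∪ Γ)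
  chained : IsProtocolSet ({chain lam P Q c d} ∪ Γ)
  first : Set S.RunId
  others : Set S.RunId
  π : S.RunId → S.RunId
  π_injective : Function.Injective π
  π_others : ∀ i ∈ others, π i = i
  π_first : ∀ i ∈ first, π i ∉ first ∪ others

namespace ChainSim

/-! ### The renaming of nonces and the compatibility of the typings -/

variable (C : ChainSim S)

noncomputable abbrev R : Protocol S := chain C.lam C.P C.Q C.c C.d

noncomputable abbrev chainSet : Set (Protocol S) := {C.R} ∪ C.Γ

abbrev splitSet : Set (Protocol S) := {C.P, C.Q} ∪ C.Γ

noncomputable abbrev spec (rsP rsQ : RoleSpec S) : RoleSpec S := chainSpec C.lam C.c C.d rsP rsQ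

open Classical in
/-- The replacement of run identifiers in constants of the second protocol. -/
noncomputable def τ : Nonce S → Nonce S
  | .run x i => if x ∈ C.Q.idents then .run x (C.π i) else .run x i
  | .intruder n => .intruder n

theorem τ_injective : Function.Injective C.τ := by
  intro a b h
  rcases a with ⟨x, i⟩ | n <;> rcases b with ⟨y, j⟩ | m <;> simp only [τ] at h
  · split_ifs at h with h1 h2 h2 <;> simp only [Nonce.run.injEq] at h
    · rw [h.1, C.π_injective h.2]
    · exact (h2 (h.1 ▸ h1)).elim
    · exact (h1 (h.1 ▸ h2)).elim
    · rw [h.1, h.2]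
  · split_ifs at h
  · split_ifs at h
  · exact h

theorem rename_τ_of_noRun {K : Set (RunTerm S)} (hK : IsInitialKnowledge K) {t : RunTerm S}
    (ht : t ∈ K) : RunTerm.rename C.τ t = t := by
  conv_rhs => rw [← Term.map_id t]
  refine Term.map_congr t fun a ha => ?_
  rcases a with a | ⟨x, i⟩ | n
  · rfl
  · exact (hK.noRun t ht x i ha).elim
  · rfl

/-- The simulated instantiation of a run outside of the chaining composition. -/
noncomputable abbrev pullOther (rs : RoleSpec S) : Inst S → Inst S :=
  Inst.pull rs.typ rs.typ id C.τ id

/-- The simulated instantiation of the first protocol. -/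
noncomputable abbrev pullFirst (rsP rsQ : RoleSpec S) : Inst S → Inst S :=
  Inst.pull (C.spec rsP rsQ).typ rsP.typ id C.τ id

/-- The simulated instantiation of the second protocol. -/
noncomputable abbrev pullSecond (rsP rsQ : RoleSpec S) : Inst S → Inst S :=
  Inst.pull (C.spec rsP rsQ).typ rsQ.typ (identSubst C.c C.d) C.τ C.π

variable {C} {r : S.Role} {rs rsP rsQ : RoleSpec S} {inst : Inst S}

theorem mem_P : C.P ∈ C.splitSet := Or.inl (Or.inl rfl)

theorem mem_Q : C.Q ∈ C.splitSet := Or.inl (Or.inr rfl)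

theorem mem_R : C.R ∈ C.chainSet := Or.inl rfl

theorem not_mem_Q_of_P (hP : C.P r = some rsP) {x : S.Ident} (hx : (rsP.typ x).isSome = true) :
    x ∉ C.Q.idents :=
  Set.disjoint_left.1 C.defined.idents_disjoint ⟨r, rsP, hP, hx⟩

theorem typ_P_eq_none (hP : C.P r = some rsP) (hQ : C.Q r = some rsQ) {x : S.Ident}
    (hx : (rsQ.typ x).isSome = true) : rsP.typ x = none := by
  by_contra h
  exact not_mem_Q_of_P hP (Option.isSome_iff_ne_none.2 h) ⟨r, rsQ, hQ, hx⟩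

/-- Otherwise `d`, which is typed in `Q`, would violate the disjointness of the identifiers. -/
theorem P_ne_Q (hQ : C.Q r = some rsQ) : C.P ≠ C.Q := by
  intro h
  have hx : (rsQ.typ C.d).isSome = true := by rw [C.defined.param r rsQ hQ]; rfl
  exact not_mem_Q_of_P (C := C) (h ▸ hQ) hx ⟨r, rsQ, hQ, hx⟩

theorem typ_spec_second (hP : C.P r = some rsP) (hQ : C.Q r = some rsQ)
    (hc : (rsP.typ C.c).isSome = true) {x : S.Ident} (hx : (rsQ.typ x).isSome = true)
    (hd : x ≠ C.d) : (C.spec rsP rsQ).typ x = rsQ.typ x := by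
  refine chainSpec_typ_right (typ_P_eq_none hP hQ hx) ?_ hd
  rintro rfl
  rw [typ_P_eq_none hP hQ hx] at hc
  cases hc

/-- Protocols in `Γ` may use identifiers of `Q` as constants; `τ` does not touch them because `π`
fixes the run identifiers in `others`. -/
theorem constCompat_other (hi : inst.rid ∈ C.others) :
    ConstCompat rs.typ rs.typ id C.τ id inst.rid := by
  refine fun x hx => ⟨hx, ?_⟩
  simp [τ, C.π_others _ hi]

theorem flexCompat_other : FlexCompat rs.typ rs.typ id inst :=
  fun _ _ => Or.inr ⟨rfl, fun _ _ h => h⟩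

theorem constCompat_first (hP : C.P r = some rsP) (i : S.RunId) :
    ConstCompat (C.spec rsP rsQ).typ rsP.typ id C.τ id i := by
  intro x hx
  have hx' : (rsP.typ x).isSome = true := by rw [hx]; rfl
  refine ⟨(chainSpec_typ_left rsQ hx').trans hx, ?_⟩
  simp [τ, not_mem_Q_of_P hP hx']

theorem flexCompat_first : FlexCompat (C.spec rsP rsQ).typ rsP.typ id inst :=
  fun _ hx => Or.inr
    ⟨chainSpec_typ_left rsQ (by rcases hx with hx | hx <;> simp [hx]), fun _ _ h => h⟩

theorem constCompat_second (hP : C.P r = some rsP) (hQ : C.Q r = some rsQ)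
    (hc : (rsP.typ C.c).isSome = true) (i : S.RunId) :
    ConstCompat (C.spec rsP rsQ).typ rsQ.typ (identSubst C.c C.d) C.τ C.π i := by
  intro x hx
  have hx' : (rsQ.typ x).isSome = true := by rw [hx]; rfl
  have hd : x ≠ C.d := by
    rintro rfl
    rw [C.defined.param r rsQ hQ] at hx
    cases hx
  rw [identSubst_of_ne _ hd]
  refine ⟨(typ_spec_second hP hQ hc hx' hd).trans hx, ?_⟩
  have : x ∈ C.Q.idents := ⟨r, rsQ, hQ, hx'⟩
  simp [τ, this]

/-- The parameter `d` stands for `c`, which already has a value, so no read binds it. Any other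
identifier stands for itself alone: `c` is typed in `P`, hence not in `Q`. -/
theorem flexCompat_second (hP : C.P r = some rsP) (hQ : C.Q r = some rsQ)
    (hc : (rsP.typ C.c).isSome = true)
    (hv : (inst.value (C.spec rsP rsQ).typ C.c).isSome = true) :
    FlexCompat (C.spec rsP rsQ).typ rsQ.typ (identSubst C.c C.d) inst := by
  intro x hx
  by_cases hd : x = C.d
  · subst hd
    rw [identSubst_self]
    exact Or.inl hv
  · have hx' : (rsQ.typ x).isSome = true := by rcases hx with hx | hx <;> rw [hx] <;> rfl
    rw [identSubst_of_ne _ hd]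
    refine Or.inr ⟨typ_spec_second hP hQ hc hx' hd, fun y _ hy => ?_⟩
    by_cases hy' : y = C.d
    · subst hy'
      rw [identSubst_self] at hy
      rw [hy, typ_P_eq_none hP hQ hx'] at hc
      cases hc
    · rwa [identSubst_of_ne _ hy'] at hy

theorem idents_typed {Ps : Set (Protocol S)} (h : IsProtocolSet Ps) {P : Protocol S}
    (hP : P ∈ Ps) (hr : P r = some rs) {ev : Event S} (hev : ev ∈ rs.events) :
    ∀ x ∈ ev.idents, (rs.typ x).isSome = true :=
  ((h.1 P hP).1 r rs hr).2 ev hev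

/-! ### The simulation relation and its preservation -/

/-- `j` is the run identifier of one of the runs that simulate the run identified by `i`. -/
def RidImg (C : ChainSim S) (i j : S.RunId) : Prop := j = i ∨ (i ∈ C.first ∧ j = C.π i)

/-- The identifiers `π i` for `i` in `first` are outside `first ∪ others`, so the identifier of a
simulating run determines the run that it simulates. -/
theorem RidImg.unique {i i' j : S.RunId} (h : C.RidImg i j) (h' : C.RidImg i' j)
    (hi : i ∈ C.first ∪ C.others) (hi' : i' ∈ C.first ∪ C.others) : i = i' := by
  rcases h with rfl | ⟨h1, rfl⟩ <;> rcases h' with h' | ⟨h1', h'⟩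
  · exact h'
  · exact (C.π_first _ h1' (h' ▸ hi)).elim
  · exact (C.π_first _ h1 (h' ▸ hi')).elim
  · exact C.π_injective h'

/-- The stages in the simulation of a run. -/
inductive Phase
  | other
  | first
  | second

/-- The runs `R` contain a run that simulates the given run. -/
inductive Img (C : ChainSim S) (R : Set (Run S)) : Phase → Run S → Prop
  | other {P' : Protocol S} {r : S.Role} {rs : RoleSpec S} {inst : Inst S}
      {rest : List (Event S)} :
      P' ∈ C.Γ → P' ≠ C.R → P' r = some rs → inst.rid ∈ C.others → (∀ ev ∈ rest, ev ∈ rs.events) →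
      ⟨rs, C.pullOther rs inst, rest⟩ ∈ R → Img C R .other ⟨rs, inst, rest⟩
  | first {r : S.Role} {rsP rsQ : RoleSpec S} {inst : Inst S} {s : List (Event S)}
      {l : S.Label} :
      C.P r = some rsP → C.Q r = some rsQ → inst.rid ∈ C.first →
      (s ++ [.finish l r]) <:+ rsP.events →
      (∀ x, rsP.typ x = none →
        ((inst.σ x).isSome = true ↔ (C.spec rsP rsQ).typ x = some .param)) →
      (∀ r', (inst.ρ r').isSome = true ↔ r' ∈ C.Q.dom) →
      (∀ run ∈ R, run.inst.rid ≠ C.π inst.rid) →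
      ⟨rsP, C.pullFirst rsP rsQ inst, s ++ [.finish l r]⟩ ∈ R →
      Img C R .first ⟨C.spec rsP rsQ, inst, s.map (Event.map C.lam (RoleTerm.rename id)) ++
        rsQ.events.tail.map (Event.map C.lam (RoleTerm.rename (identSubst C.c C.d)))⟩
  | second {r : S.Role} {rsP rsQ : RoleSpec S} {inst : Inst S} {s : List (Event S)} :
      C.P r = some rsP → C.Q r = some rsQ → inst.rid ∈ C.first →
      (∀ ev ∈ s, ev ∈ rsQ.events) → (rsP.typ C.c).isSome = true →
      (inst.value (C.spec rsP rsQ).typ C.c).isSome = true →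
      ⟨rsQ, C.pullSecond rsP rsQ inst, s⟩ ∈ R →
      Img C R .second ⟨C.spec rsP rsQ, inst,
        s.map (Event.map C.lam (RoleTerm.rename (identSubst C.c C.d)))⟩

/-- An image depends only on the simulating runs with identifier `i` or `π i`, including the
requirement that `π i` is still unused in the first phase. -/
theorem Img.congr {R R' : Set (Run S)} {ph : Phase} {run : Run S} (h : C.Img R ph run)
    (hR : ∀ run', C.RidImg run.inst.rid run'.inst.rid → (run' ∈ R' ↔ run' ∈ R)) :
    C.Img R' ph run := by
  cases h with
  | other h1 h2 h3 h4 h5 h6 => exact .other h1 h2 h3 h4 h5 ((hR _ (by exact Or.inl rfl)).2 h6)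
  | first h1 h2 h3 h4 h5 h6 h7 h8 =>
    exact .first h1 h2 h3 h4 h5 h6
      (fun run hrun hrid => h7 _ ((hR _ (Or.inr ⟨h3, hrid⟩)).1 hrun) hrid)
      ((hR _ (by exact Or.inl rfl)).2 h8)
  | second h1 h2 h3 h4 h5 h6 h7 =>
    exact .second h1 h2 h3 h4 h5 h6 ((hR _ (by exact Or.inr ⟨h3, rfl⟩)).2 h7)

theorem Img.rid_mem {R : Set (Run S)} {ph : Phase} {run : Run S} (h : C.Img R ph run) :
    run.inst.rid ∈ C.first ∪ C.others := by
  cases h with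
  | other h1 h2 h3 h4 => exact Or.inr h4
  | first h1 h2 h3 => exact Or.inl h3
  | second h1 h2 h3 => exact Or.inl h3

/-- The second event simulates the first one. -/
inductive EventImg (C : ChainSim S) : RunEvent S → RunEvent S → Prop
  | other {e e' : RunEvent S} : e.ev.label ∉ C.R.labels → EventImg C e e'
  | first {r : S.Role} {rsP rsQ : RoleSpec S} (inst : Inst S) {ev : Event S} :
      C.P r = some rsP → C.Q r = some rsQ → ev ∈ rsP.events →
      EventImg C ⟨inst, ev.map C.lam (RoleTerm.rename id)⟩ ⟨C.pullFirst rsP rsQ inst, ev⟩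
  | second {r : S.Role} {rsP rsQ : RoleSpec S} (inst : Inst S) {ev : Event S} :
      C.P r = some rsP → C.Q r = some rsQ → (rsP.typ C.c).isSome = true → ev ∈ rsQ.events →
      EventImg C ⟨inst, ev.map C.lam (RoleTerm.rename (identSubst C.c C.d))⟩
        ⟨C.pullSecond rsP rsQ inst, ev⟩

/-- The instantiation of the event comes from an event of the trace `α`. -/
inductive Source (C : ChainSim S) (α : Trace S) : RunEvent S → Prop
  | other {P' : Protocol S} {r : S.Role} {rs : RoleSpec S} {e : RunEvent S} :
      P' ∈ C.Γ → P' r = some rs → e.ev ∈ rs.events → Source C α e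
  | first {r : S.Role} {rsP rsQ : RoleSpec S} {e : RunEvent S} {ev : Event S} :
      C.P r = some rsP → C.Q r = some rsQ → ev ∈ rsP.events → e ∈ α →
      e.ev ∈ (C.spec rsP rsQ).events → Source C α ⟨C.pullFirst rsP rsQ e.inst, ev⟩
  | second {r : S.Role} {rsP rsQ : RoleSpec S} {e : RunEvent S} {ev : Event S} :
      C.P r = some rsP → C.Q r = some rsQ → (rsP.typ C.c).isSome = true → ev ∈ rsQ.events →
      e ∈ α → e.ev ∈ (C.spec rsP rsQ).events → Source C α ⟨C.pullSecond rsP rsQ e.inst, ev⟩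

theorem Source.mono {α α' : Trace S} (h : ∀ e ∈ α, e ∈ α') {e : RunEvent S}
    (hs : C.Source α e) : C.Source α' e := by
  cases hs with
  | other h1 h2 h3 => exact .other h1 h2 h3
  | first h1 h2 h3 h4 h5 => exact .first h1 h2 h3 (h _ h4) h5
  | second h1 h2 h3 h4 h5 h6 => exact .second h1 h2 h3 h4 (h _ h5) h6

/-- Every input comes from the event right before it. -/
def InputOk (C : ChainSim S) (β : Trace S) : Prop :=
  ∀ r ρ t j, j ∈ inputPositions {C.Q} C.d β r ρ t →
    ∃ j', j = j' + 1 ∧ j' ∈ outputPositions {C.P} C.c β r ρ t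

theorem InputOk.snoc {β : Trace S} {e : RunEvent S} (h : C.InputOk β)
    (he : ∀ l r t, e.ev = .create l r → HasValue {C.Q} e (.atom (.ident C.d)) t →
      ∃ j, β.length = j + 1 ∧ j ∈ outputPositions {C.P} C.c β r e.inst.ρ t) :
    C.InputOk (β ++ [e]) := by
  have hout : ∀ {r ρ t j}, j ∈ outputPositions {C.P} C.c β r ρ t →
      j ∈ outputPositions {C.P} C.c (β ++ [e]) r ρ t := by
    rintro r ρ t j ⟨e', l, h1, h2⟩
    refine ⟨e', l, ?_, h2⟩
    rw [List.getElem?_append_left (List.getElem?_eq_some_iff.1 h1).1, h1]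
  rintro r ρ t j ⟨e', l, h1, h2, rfl, h4⟩
  by_cases hj : j < β.length
  · rw [List.getElem?_append_left hj] at h1
    obtain ⟨j', h5, h6⟩ := h _ _ _ _ ⟨e', l, h1, h2, rfl, h4⟩
    exact ⟨j', h5, hout h6⟩
  · rw [List.getElem?_append_right (not_lt.1 hj), List.getElem?_singleton] at h1
    split_ifs at h1 with h0
    cases h1
    obtain ⟨j', h5, h6⟩ := he l r t h2 h4
    exact ⟨j', by omega, hout h6⟩

/-- Positions of inputs are successors by `InputOk`, so truncated subtraction of one is injective on
them. -/
theorem InputOk.uniqueInput {β : Trace S} (h : C.InputOk β) :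
    UniqueInput {C.P} {C.Q} C.c C.d β := by
  refine fun r ρ t => ⟨fun j => j - 1, fun i hi j hj hij => ?_, fun j hj => ?_⟩
  · obtain ⟨i', rfl, -⟩ := h _ _ _ _ hi
    obtain ⟨j', rfl, -⟩ := h _ _ _ _ hj
    simpa using hij
  · obtain ⟨j', rfl, hj'⟩ := h _ _ _ _ hj
    exact ⟨hj', by simp⟩

/-- After the trace `β` of the split system, its state `s'` simulates the state `s` that the
chained system has reached by the trace `α`. -/
structure Sim (C : ChainSim S) (α β : Trace S) (s s' : State S) : Prop where
  deriv : Derivation C.splitSet ⟨C.IK₀ C.splitSet, ∅⟩ β s'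
  know : ∀ t ∈ s.know, RunTerm.rename C.τ t ∈ s'.know
  imgs : ∀ run ∈ s.runs, ∃ ph, C.Img s'.runs ph run
  rids : ∀ run' ∈ s'.runs, ∃ run ∈ s.runs, C.RidImg run.inst.rid run'.inst.rid
  events : ∃ β', β'.Sublist β ∧ List.Forall₂ C.EventImg α β'
  source : ∀ e ∈ β, C.Source α e
  input : C.InputOk β

/-- What all executed events have in common. Images of different runs have different identifiers by
`RidImg.unique`, so replacing one simulating run leaves the images of the other runs intact. -/
theorem Sim.exec {α β : Trace S} {s s' : State S} (h : C.Sim α β s s')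
    (hA : Reached C.chainSet α s) {rsA rsB : RoleSpec S} {inst inst' instB instB' : Inst S}
    {evA evB : Event S} {restA restB : List (Event S)} {KA KB : Set (RunTerm S)}
    (hrun : ⟨rsA, inst, evA :: restA⟩ ∈ s.runs) (hrunB : ⟨rsB, instB, evB :: restB⟩ ∈ s'.runs)
    (hrid : C.RidImg inst.rid instB.rid)
    (hex : Exec s.know rsA inst evA restA inst' KA)
    (hexB : Exec s'.know rsB instB evB restB instB' KB)
    (hK : ∀ t ∈ KA, RunTerm.rename C.τ t ∈ KB)
    (himg : ∃ ph, C.Img (replaceRun s'.runs ⟨rsB, instB, evB :: restB⟩ ⟨rsB, instB', restB⟩) ph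
      ⟨rsA, inst', restA⟩)
    (hev : C.EventImg ⟨inst', evA⟩ ⟨instB', evB⟩)
    (hsrc : C.Source (α ++ [⟨inst', evA⟩]) ⟨instB', evB⟩) :
    C.Sim (α ++ [⟨inst', evA⟩]) (β ++ [⟨instB', evB⟩])
      ⟨KA, replaceRun s.runs ⟨rsA, inst, evA :: restA⟩ ⟨rsA, inst', restA⟩⟩
      ⟨KB, replaceRun s'.runs ⟨rsB, instB, evB :: restB⟩ ⟨rsB, instB', restB⟩⟩ := by
  refine ⟨h.deriv.snoc (hexB.step hrunB), hK, ?_, ?_, ?_, ?_, ?_⟩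
  · intro run hr
    rcases mem_replaceRun.1 hr with rfl | ⟨hr, hne⟩
    · exact himg
    · obtain ⟨ph, hph⟩ := h.imgs run hr
      obtain ⟨ph₀, hph₀⟩ := h.imgs _ hrun
      have hne' : ¬ C.RidImg run.inst.rid instB.rid := fun h' =>
        hne (hA.eq_of_rid _ hr _ hrun (h'.unique hrid hph.rid_mem hph₀.rid_mem))
      refine ⟨ph, hph.congr fun run' hrun' => ?_⟩
      rw [mem_replaceRun]
      constructor
      · rintro (rfl | h')
        · exact (hne' (hexB.rid_eq ▸ hrun')).elim
        · exact h'.1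
      · refine fun h' => Or.inr ⟨h', ?_⟩
        rintro rfl
        exact hne' hrun'
  · intro run' hr'
    rcases mem_replaceRun.1 hr' with rfl | ⟨hr', -⟩
    · refine ⟨_, mem_replaceRun.2 (Or.inl rfl), ?_⟩
      simp only [hex.rid_eq, hexB.rid_eq]
      exact hrid
    · obtain ⟨run, hr, hi⟩ := h.rids run' hr'
      by_cases heq : run = ⟨rsA, inst, evA :: restA⟩
      · subst heq
        refine ⟨_, mem_replaceRun.2 (Or.inl rfl), ?_⟩
        simp only [hex.rid_eq]
        exact hi
      · exact ⟨run, mem_replaceRun.2 (Or.inr ⟨hr, heq⟩), hi⟩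
  · obtain ⟨β', h1, h2⟩ := h.events
    exact ⟨β' ++ [⟨instB', evB⟩], h1.append (List.Sublist.refl _),
      List.rel_append h2 (.cons hev .nil)⟩
  · intro e he
    rcases List.mem_append.1 he with he | he
    · exact (h.source e he).mono fun _ => List.mem_append_left _
    · rw [List.mem_singleton.1 he]
      exact hsrc
  · exact h.input.snoc fun l r t hc => (hexB.not_create l r hc).elim

theorem hasValue_split {e : RunEvent S} {x : RoleTerm S} {t : RunTerm S} {P' : Protocol S}
    (hP' : P' ∈ C.splitSet) (h : HasValue {P'} e x t) : HasValue C.splitSet e x t := by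
  obtain ⟨_, rfl, h⟩ := h
  exact ⟨_, hP', h⟩

/-- A run that has executed all events of the first protocol goes over to the second one. -/
theorem Sim.handover {α β : Trace S} {s s' : State S} (h : C.Sim α β s s')
    (hA : Reached C.chainSet α s) {l : S.Label} (hP : C.P r = some rsP) (hQ : C.Q r = some rsQ)
    (hi : inst.rid ∈ C.first) (hl : .finish l r ∈ rsP.events)
    (hσ : ∀ x, rsP.typ x = none →
      ((inst.σ x).isSome = true ↔ (C.spec rsP rsQ).typ x = some .param))
    (hρ : ∀ r', (inst.ρ r').isSome = true ↔ r' ∈ C.Q.dom)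
    (hfresh : ∀ run ∈ s'.runs, run.inst.rid ≠ C.π inst.rid)
    (hrunB : ⟨rsP, C.pullFirst rsP rsQ inst, [.finish l r]⟩ ∈ s'.runs)
    (hrun : ⟨C.spec rsP rsQ, inst,
      rsQ.events.tail.map (Event.map C.lam (RoleTerm.rename (identSubst C.c C.d)))⟩ ∈ s.runs) :
    ∃ β' s'', C.Sim α β' s s'' ∧ C.Img s''.runs .second ⟨C.spec rsP rsQ, inst,
      rsQ.events.tail.map (Event.map C.lam (RoleTerm.rename (identSubst C.c C.d)))⟩ := by
  set runA : Run S := ⟨C.spec rsP rsQ, inst,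
    rsQ.events.tail.map (Event.map C.lam (RoleTerm.rename (identSubst C.c C.d)))⟩ with hrunA
  -- The two inserted events correspond to no event of `α`; their `Source` is the latest event `e₀`
  -- of the chained run, which has the current instantiation.
  obtain ⟨e₀, he₀, hinst₀, hev₀⟩ := hA.last _ hrun
  have hinst₀ : e₀.inst = inst := hinst₀
  set e₁ : RunEvent S := ⟨C.pullFirst rsP rsQ inst, .finish l r⟩ with he₁
  -- The label is that of the create event of `Q`, read off the head of the list; the default `l` is
  -- never used, since the list is nonempty.
  set e₂ : RunEvent S := ⟨C.pullSecond rsP rsQ inst,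
    .create (rsQ.events.head?.elim l Event.label) r⟩ with he₂
  have hex : Exec s'.know rsP (C.pullFirst rsP rsQ inst) (.finish l r) []
      (C.pullFirst rsP rsQ inst) s'.know := ⟨rfl, rfl, rfl⟩
  have hd₁ := h.deriv.snoc (hex.step hrunB)
  -- The trace extended by the end event is a trace of a system containing `P`, so `c` is defined
  -- there, and in particular typed in this role of `P`.
  obtain ⟨t, ht⟩ := C.defined.establishes C.splitSet C.split mem_P _ ⟨_, hd₁⟩ e₁ (by simp [e₁]) l
    ⟨r, rsP, hP, _, hl, rfl⟩ r rfl
  have ht := (hasValue_split mem_P ht).apply C.split mem_P hP hl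
  have hcval : ((C.pullFirst rsP rsQ inst).value rsP.typ C.c).isSome = true := by
    rw [Inst.apply_ident] at ht
    rw [← Option.isSome_map (f := fun n => (Term.atom (.nonce n) : RunTerm S)), ht]
    rfl
  have hc := Inst.isSome_typ_of_value hcval
  have hcv : (inst.value (C.spec rsP rsQ).typ C.c).isSome = true := by
    rw [Inst.value_pull (constCompat_first hP _) hc, Option.isSome_map] at hcval
    exact hcval
  obtain ⟨⟨l₂, body, l₃, hbody, -⟩, -⟩ := (C.split.1 _ mem_Q).1 r rsQ hQ
  have hl₂ : rsQ.events = .create l₂ r :: rsQ.events.tail := by rw [hbody]; rfl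
  have he₂ev : e₂.ev = .create l₂ r := by simp [e₂, hbody, Event.label]
  -- The input `d` has the value of `c`. By `hσ`, the other parameters of `Q` have had values since
  -- the creation of the chained run, and the variables of `Q` have none yet.
  have hinit : IsInitial C.Q rsQ (C.pullSecond rsP rsQ inst) := by
    refine ⟨hρ, fun x => ?_⟩
    by_cases hd : x = C.d
    · subst hd
      simp [Inst.pull, C.defined.param r rsQ hQ, identSubst_self, hcv]
    · simp only [Inst.pull, identSubst_of_ne _ hd]
      split
      · next hx =>
        have hx' : (rsQ.typ x).isSome = true := by rw [hx]; rfl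
        have htyp := typ_spec_second hP hQ hc hx' hd
        simp [Inst.value, htyp, hx, hσ x (typ_P_eq_none hP hQ hx')]
      · next hx =>
        have hx' : (rsQ.typ x).isSome = true := by rw [hx]; rfl
        have htyp := typ_spec_second hP hQ hc hx' hd
        simp [Inst.value, htyp, hx, hσ x (typ_P_eq_none hP hQ hx')]
      · next h1 h2 => simpa using h1
  set R₁ := replaceRun s'.runs ⟨rsP, C.pullFirst rsP rsQ inst, [.finish l r]⟩
    ⟨rsP, C.pullFirst rsP rsQ inst, []⟩ with hR₁
  have hne : inst.rid ≠ C.π inst.rid := fun h' => C.π_first _ hi (h' ▸ Or.inl hi)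
  have hfresh₁ : ∀ run ∈ R₁, run.inst.rid ≠ C.π inst.rid := by
    intro run hr
    rcases mem_replaceRun.1 hr with rfl | ⟨hr, -⟩
    · exact hne
    · exact hfresh run hr
  have hstep₂ : Step C.splitSet ⟨s'.know, R₁⟩ e₂
      ⟨s'.know, insert ⟨rsQ, C.pullSecond rsP rsQ inst, rsQ.events.tail⟩ R₁⟩ := by
    rw [show e₂ = ⟨C.pullSecond rsP rsQ inst, .create l₂ r⟩ by rw [← he₂ev]]
    exact .create mem_Q hQ hl₂ hinit hfresh₁
  have hmem₂ : e₂.ev ∈ rsQ.events := by rw [he₂ev, hl₂]; exact List.mem_cons_self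
  have htail : ∀ ev ∈ rsQ.events.tail, ev ∈ rsQ.events := fun ev => List.mem_of_mem_tail
  have himg : C.Img (insert ⟨rsQ, C.pullSecond rsP rsQ inst, rsQ.events.tail⟩ R₁) .second runA :=
    .second hP hQ hi htail hc hcv (Or.inl rfl)
  refine ⟨β ++ [e₁] ++ [e₂], _, ⟨hd₁.snoc hstep₂, h.know, ?_, ?_, ?_, ?_, ?_⟩, himg⟩
  · intro run hr
    by_cases heq : run = runA
    · subst heq
      exact ⟨_, himg⟩
    · obtain ⟨ph, hph⟩ := h.imgs run hr
      refine ⟨ph, hph.congr fun run' hrun' => ?_⟩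
      have key : ∀ {j}, C.RidImg inst.rid j → run'.inst.rid ≠ j := by
        rintro j hj rfl
        exact heq (hA.eq_of_rid _ hr _ hrun (hrun'.unique hj hph.rid_mem (Or.inl hi)))
      rw [Set.mem_insert_iff, mem_replaceRun]
      constructor
      · rintro (rfl | rfl | h')
        · exact (key (Or.inr ⟨hi, rfl⟩) rfl).elim
        · exact (key (Or.inl rfl) rfl).elim
        · exact h'.1
      · refine fun h' => Or.inr (Or.inr ⟨h', ?_⟩)
        rintro rfl
        exact key (Or.inl rfl) rfl
  · rintro run' (rfl | hr')
    · exact ⟨runA, hrun, Or.inr ⟨hi, rfl⟩⟩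
    · rcases mem_replaceRun.1 hr' with rfl | ⟨hr', -⟩
      · exact ⟨runA, hrun, Or.inl rfl⟩
      · exact h.rids run' hr'
  · obtain ⟨β', h1, h2⟩ := h.events
    exact ⟨β', by rw [List.append_assoc]; exact h1.trans (List.sublist_append_left _ _), h2⟩
  · intro e he
    rcases List.mem_append.1 he with he | he
    · rcases List.mem_append.1 he with he | he
      · exact h.source e he
      · rw [List.mem_singleton.1 he, he₁, ← hinst₀]
        exact .first hP hQ hl he₀ hev₀
    · rw [List.mem_singleton.1 he, he₂, ← hinst₀]
      exact .second hP hQ hc hmem₂ he₀ hev₀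
  · refine (h.input.snoc fun l' r' t' hc' => by cases hc').snoc fun l' r' t' hc' hv => ?_
    rw [he₂ev] at hc'
    cases hc'
    have hv := (hasValue_split mem_Q hv).apply C.split mem_Q hQ hmem₂
    -- The position `β.length` is that of the end event `e₁`. The values at `c` and `d` agree
    -- because both are the renamed value of `c` in the chained run.
    refine ⟨β.length, by simp, e₁, l, by simp, rfl, rfl, _, rfl, r, rsP, hP, hl, ?_⟩
    have hd : (rsQ.typ C.d).isSome = true := by rw [C.defined.param r rsQ hQ]; rfl
    rw [Inst.apply_ident, Inst.value_pull (constCompat_second hP hQ hc _) hd,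
      identSubst_self] at hv
    rw [Inst.apply_ident, Inst.value_pull (constCompat_first hP _) hc]
    exact hv

/-- The creation of a run is simulated by the creation of a run with the same run identifier. -/
theorem Sim.create {α β : Trace S} {s s' : State S} (h : C.Sim α β s s')
    {P' : Protocol S} {l lB : S.Label} {rsB : RoleSpec S} {instB : Inst S}
    {rest restB : List (Event S)} (hP' : P' ∈ C.splitSet) (hQ : P' ≠ C.Q) (hr : P' r = some rsB)
    (hev : rsB.events = .create lB r :: restB) (hinit : IsInitial P' rsB instB)
    (hfresh : ∀ run ∈ s.runs, run.inst.rid ≠ inst.rid)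
    (hmem : inst.rid ∈ C.first ∪ C.others) (hrid : instB.rid = inst.rid)
    (himg : (∀ run ∈ s'.runs, ¬ C.RidImg inst.rid run.inst.rid) →
      ∃ ph, C.Img (insert ⟨rsB, instB, restB⟩ s'.runs) ph ⟨rs, inst, rest⟩)
    (hevimg : C.EventImg ⟨inst, .create l r⟩ ⟨instB, .create lB r⟩)
    (hsrc : C.Source (α ++ [⟨inst, .create l r⟩]) ⟨instB, .create lB r⟩) :
    C.Sim (α ++ [⟨inst, .create l r⟩]) (β ++ [⟨instB, .create lB r⟩])
      ⟨s.know, insert ⟨rs, inst, rest⟩ s.runs⟩ ⟨s'.know, insert ⟨rsB, instB, restB⟩ s'.runs⟩ := by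
  have hnot : ∀ run ∈ s'.runs, ¬ C.RidImg inst.rid run.inst.rid := by
    intro run' hr' hi'
    obtain ⟨run, hr, hi⟩ := h.rids run' hr'
    obtain ⟨ph, hph⟩ := h.imgs run hr
    exact hfresh run hr (hi.unique hi' hph.rid_mem hmem)
  have hstep : Step C.splitSet s' ⟨instB, .create lB r⟩
      ⟨s'.know, insert ⟨rsB, instB, restB⟩ s'.runs⟩ :=
    .create hP' hr hev hinit fun run hrun hrid' => hnot run hrun (Or.inl (hrid'.trans hrid))
  refine ⟨h.deriv.snoc hstep, h.know, ?_, ?_, ?_, ?_, ?_⟩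
  · rintro run (rfl | hr)
    · exact himg hnot
    · obtain ⟨ph, hph⟩ := h.imgs run hr
      refine ⟨ph, hph.congr fun run' hrun' => or_iff_right ?_⟩
      rintro rfl
      exact hfresh run hr (hrun'.unique (Or.inl hrid) hph.rid_mem hmem)
  · rintro run' (rfl | hr')
    · exact ⟨_, Or.inl rfl, Or.inl hrid⟩
    · obtain ⟨run, hr, hi⟩ := h.rids run' hr'
      exact ⟨run, Or.inr hr, hi⟩
  · obtain ⟨β', h1, h2⟩ := h.events
    exact ⟨β' ++ [⟨instB, .create lB r⟩], h1.append (List.Sublist.refl _),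
      List.rel_append h2 (.cons hevimg .nil)⟩
  · intro e he
    rcases List.mem_append.1 he with he | he
    · exact (h.source e he).mono fun _ => List.mem_append_left _
    · rw [List.mem_singleton.1 he]
      exact hsrc
  · refine h.input.snoc fun l' r' t _ hv => (hQ ?_).elim
    obtain ⟨_, rfl, r'', rs'', hr'', hev'', -⟩ := hv
    exact (C.split.spec_unique hP' mem_Q hr hr'' (by rw [hev]; exact List.mem_cons_self) hev'').1

end ChainSim

/-! ### Simulation of the steps of the chained system -/

namespace ChainSim

variable {C : ChainSim S} {r : S.Role} {rs rsP rsQ : RoleSpec S} {inst inst' : Inst S}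
  {α β : Trace S} {s s' : State S} {KA : Set (RunTerm S)}

theorem spec_mem (hP : C.P r = some rsP) (hQ : C.Q r = some rsQ) :
    C.R r = some (C.spec rsP rsQ) :=
  chain_eq_some.2 ⟨rsP, rsQ, hP, hQ, rfl⟩

theorem label_not_mem_R {P' : Protocol S} (hP' : P' ∈ C.Γ) (hne : P' ≠ C.R)
    (hr : P' r = some rs) {ev : Event S} (hev : ev ∈ rs.events) : ev.label ∉ C.R.labels :=
  Set.disjoint_left.1 (C.chained.2 P' (Or.inr hP') C.R mem_R hne) ⟨r, rs, hr, ev, hev, rfl⟩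

theorem Sim.exec_other (h : C.Sim α β s s') (hA : Reached C.chainSet α s) {P' : Protocol S}
    {ev : Event S} {rest : List (Event S)} (hP' : P' ∈ C.Γ) (hne : P' ≠ C.R)
    (hr : P' r = some rs) (hi : inst.rid ∈ C.others) (hrest : ∀ ev' ∈ ev :: rest, ev' ∈ rs.events)
    (hrunB : ⟨rs, C.pullOther rs inst, ev :: rest⟩ ∈ s'.runs)
    (hrun : ⟨rs, inst, ev :: rest⟩ ∈ s.runs) (hex : Exec s.know rs inst ev rest inst' KA) :
    ∃ β' s'', C.Sim (α ++ [⟨inst', ev⟩]) β'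
      ⟨KA, replaceRun s.runs ⟨rs, inst, ev :: rest⟩ ⟨rs, inst', rest⟩⟩ s'' := by
  have hev := hrest ev List.mem_cons_self
  have hex' : Exec s.know rs inst (ev.map id (RoleTerm.rename id)) rest inst' KA := by
    rwa [RoleTerm.rename_id, Event.map_id_id]
  obtain ⟨KB, hexB, hK⟩ := hex'.pull (constCompat_other hi) flexCompat_other
    (idents_typed C.split (Or.inr hP') hr hev) h.know id
  refine ⟨_, _, h.exec hA hrun hrunB (Or.inl rfl) hex hexB hK ⟨.other, ?_⟩
    (.other (label_not_mem_R hP' hne hr hev)) (.other hP' hr hev)⟩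
  exact .other hP' hne hr (hex.rid_eq ▸ hi) (fun ev' h' => hrest ev' (List.mem_cons_of_mem _ h'))
    (mem_replaceRun.2 (Or.inl rfl))

theorem Sim.exec_first (h : C.Sim α β s s') (hA : Reached C.chainSet α s)
    {ev : Event S} {rest : List (Event S)} {l : S.Label}
    (hP : C.P r = some rsP) (hQ : C.Q r = some rsQ) (hi : inst.rid ∈ C.first)
    (hsuf : (ev :: rest ++ [.finish l r]) <:+ rsP.events)
    (hσ : ∀ x, rsP.typ x = none →
      ((inst.σ x).isSome = true ↔ (C.spec rsP rsQ).typ x = some .param))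
    (hρ : ∀ r', (inst.ρ r').isSome = true ↔ r' ∈ C.Q.dom)
    (hfresh : ∀ run ∈ s'.runs, run.inst.rid ≠ C.π inst.rid)
    (hrunB : ⟨rsP, C.pullFirst rsP rsQ inst, ev :: rest ++ [.finish l r]⟩ ∈ s'.runs)
    {restA : List (Event S)} (hrestA : restA = rest.map (Event.map C.lam (RoleTerm.rename id)) ++
      rsQ.events.tail.map (Event.map C.lam (RoleTerm.rename (identSubst C.c C.d))))
    (hrun : ⟨C.spec rsP rsQ, inst, ev.map C.lam (RoleTerm.rename id) :: restA⟩ ∈ s.runs)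
    (hex : Exec s.know (C.spec rsP rsQ) inst (ev.map C.lam (RoleTerm.rename id)) restA inst' KA) :
    ∃ β' s'', C.Sim (α ++ [⟨inst', ev.map C.lam (RoleTerm.rename id)⟩]) β'
      ⟨KA, replaceRun s.runs ⟨C.spec rsP rsQ, inst, ev.map C.lam (RoleTerm.rename id) :: restA⟩
        ⟨C.spec rsP rsQ, inst', restA⟩⟩ s'' := by
  have hev : ev ∈ rsP.events := hsuf.subset (by simp)
  have htyped := idents_typed C.split mem_P hP hev
  have hevA : ev.map C.lam (RoleTerm.rename id) ∈ (C.spec rsP rsQ).events :=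
    (hA.suffix _ hrun).subset List.mem_cons_self
  -- The end event of `Q` always remains, so the condition on the last event is vacuous.
  have hne : restA ≠ [] := by
    obtain ⟨⟨l₂, body, l₃, hbody, -⟩, -⟩ := (C.split.1 _ mem_Q).1 r rsQ hQ
    simp [hrestA, hbody]
  obtain ⟨KB, hexB, hK⟩ := hex.pull (restB := rest ++ [.finish l r]) (constCompat_first hP _)
    flexCompat_first htyped h.know fun h' => (hne h').elim
  refine ⟨_, _, h.exec hA hrun hrunB (Or.inl rfl) hex hexB hK ⟨.first, ?_⟩
    (.first inst' hP hQ hev) (.first hP hQ hev (List.mem_append_right _ List.mem_cons_self) hevA)⟩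
  rw [hrestA]
  refine .first hP hQ (hex.rid_eq ▸ hi) ((List.suffix_cons _ _).trans hsuf) (fun x hx => ?_)
    (hex.ρ_eq ▸ hρ) ?_ (mem_replaceRun.2 (Or.inl rfl))
  · rw [← hσ x hx]
    -- Events of `P` contain only identifiers typed in `P`, so they cannot bind a variable of `Q`.
    refine hex.isSome_σ fun hx' => ?_
    have : x ∈ ev.idents := by
      rw [RoleTerm.rename_id] at hx'
      rcases ev with _ | _ | _ | ⟨_, _, _, _ | _⟩ | _ <;> exact hx'
    have := htyped x this
    rw [hx] at this
    cases this
  · intro run hr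
    rw [hex.rid_eq]
    rcases mem_replaceRun.1 hr with rfl | ⟨hr, -⟩
    · intro h'
      have h' : inst'.rid = C.π inst.rid := h'
      rw [hex.rid_eq] at h'
      exact C.π_first _ hi (h' ▸ Or.inl hi)
    · exact hfresh run hr

theorem Sim.exec_second (h : C.Sim α β s s') (hA : Reached C.chainSet α s)
    {ev : Event S} {rest : List (Event S)}
    (hP : C.P r = some rsP) (hQ : C.Q r = some rsQ) (hi : inst.rid ∈ C.first)
    (hrest : ∀ ev' ∈ ev :: rest, ev' ∈ rsQ.events) (hc : (rsP.typ C.c).isSome = true)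
    (hv : (inst.value (C.spec rsP rsQ).typ C.c).isSome = true)
    (hrunB : ⟨rsQ, C.pullSecond rsP rsQ inst, ev :: rest⟩ ∈ s'.runs)
    {restA : List (Event S)}
    (hrestA : restA = rest.map (Event.map C.lam (RoleTerm.rename (identSubst C.c C.d))))
    (hrun : ⟨C.spec rsP rsQ, inst,
      ev.map C.lam (RoleTerm.rename (identSubst C.c C.d)) :: restA⟩ ∈ s.runs)
    (hex : Exec s.know (C.spec rsP rsQ) inst
      (ev.map C.lam (RoleTerm.rename (identSubst C.c C.d))) restA inst' KA) :
    ∃ β' s'', C.Sim (α ++ [⟨inst', ev.map C.lam (RoleTerm.rename (identSubst C.c C.d))⟩]) β'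
      ⟨KA, replaceRun s.runs ⟨C.spec rsP rsQ, inst,
          ev.map C.lam (RoleTerm.rename (identSubst C.c C.d)) :: restA⟩
        ⟨C.spec rsP rsQ, inst', restA⟩⟩ s'' := by
  have hev := hrest ev List.mem_cons_self
  have hevA : ev.map C.lam (RoleTerm.rename (identSubst C.c C.d)) ∈ (C.spec rsP rsQ).events :=
    (hA.suffix _ hrun).subset List.mem_cons_self
  obtain ⟨KB, hexB, hK⟩ := hex.pull (restB := rest) (constCompat_second hP hQ hc _)
    (flexCompat_second hP hQ hc hv) (idents_typed C.split mem_Q hQ hev) h.know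
    fun h' => by simpa [hrestA] using h'
  refine ⟨_, _, h.exec hA hrun hrunB (Or.inr ⟨hi, rfl⟩) hex hexB hK ⟨.second, ?_⟩
    (.second inst' hP hQ hc hev)
    (.second hP hQ hc hev (List.mem_append_right _ List.mem_cons_self) hevA)⟩
  rw [hrestA]
  exact .second hP hQ (hex.rid_eq ▸ hi) (fun ev' h' => hrest ev' (List.mem_cons_of_mem _ h')) hc
    (hex.isSome_value hv) (mem_replaceRun.2 (Or.inl rfl))

theorem Sim.create_first (h : C.Sim α β s s') {l : S.Label} {rest : List (Event S)}
    (hP : C.P r = some rsP) (hQ : C.Q r = some rsQ)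
    (hev : (C.spec rsP rsQ).events = .create l r :: rest)
    (hinit : IsInitial C.R (C.spec rsP rsQ) inst)
    (hfresh : ∀ run ∈ s.runs, run.inst.rid ≠ inst.rid) (hi : inst.rid ∈ C.first) :
    ∃ β' s'', C.Sim (α ++ [⟨inst, .create l r⟩]) β'
      ⟨s.know, insert ⟨C.spec rsP rsQ, inst, rest⟩ s.runs⟩ s'' := by
  obtain ⟨⟨lP, body, lP', hbody, -⟩, -⟩ := (C.split.1 _ mem_P).1 r rsP hP
  have hevents := chainSpec_events C.lam C.c C.d rsQ
    (show rsP.events = (.create lP r :: body) ++ [.finish lP' r] from hbody)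
  have hmem : .create l r ∈ (C.spec rsP rsQ).events := by rw [hev]; exact List.mem_cons_self
  rw [hev, List.map_cons, List.cons_append, List.cons.injEq] at hevents
  obtain ⟨hl, hrest⟩ := hevents
  have hmemP : .create lP r ∈ rsP.events := by rw [hbody]; exact List.mem_cons_self
  have hdom : ∀ r', (inst.ρ r').isSome = true ↔ r' ∈ C.Q.dom := by
    intro r'
    rw [hinit.1 r']
    simp only [Protocol.dom, Set.mem_ofPred_eq, Option.isSome_iff_exists, chain_eq_some]
    constructor
    · rintro ⟨_, _, rsQ', -, hQ', -⟩
      exact ⟨rsQ', hQ'⟩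
    · rintro ⟨rsQ', hQ'⟩
      have : r' ∈ C.P.dom := by
        rw [C.defined.dom_eq]; exact Option.isSome_iff_exists.2 ⟨_, hQ'⟩
      obtain ⟨rsP', hP'⟩ := Option.isSome_iff_exists.1 this
      exact ⟨_, rsP', rsQ', hP', hQ', rfl⟩
  have hinit' : IsInitial C.P rsP (C.pullFirst rsP rsQ inst) := by
    refine ⟨fun r' => (hdom r').trans (by rw [C.defined.dom_eq]), fun x => ?_⟩
    have key : ∀ ty, rsP.typ x = some ty → (C.spec rsP rsQ).typ x = some ty := fun ty hty =>
      (chainSpec_typ_left rsQ (by rw [hty]; rfl)).trans hty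
    simp only [Inst.pull, id]
    split
    · next hx => simp [Inst.value, key _ hx, hx, hinit.2 x]
    · next hx => simp [Inst.value, key _ hx, hx, hinit.2 x]
    · next h1 h2 => simpa using h1
  refine ⟨_, _, h.create (restB := body ++ [.finish lP' r]) mem_P (P_ne_Q hQ) hP hbody hinit' hfresh
    (Or.inl hi) rfl (fun hnot => ⟨.first, ?_⟩) ?_ 
    (.first hP hQ hmemP (List.mem_append_right _ List.mem_cons_self) hmem)⟩
  · rw [hrest]
    refine .first hP hQ hi ?_ (fun x _ => hinit.2 x) hdom ?_ (Or.inl rfl)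
    · exact ⟨[.create lP r], by rw [hbody]; rfl⟩
    · rintro run (rfl | hr)
      · exact fun h' => C.π_first _ hi (h' ▸ Or.inl hi)
      · exact fun h' => hnot run hr (Or.inr ⟨hi, h'⟩)
  · rw [hl]
    exact .first inst hP hQ hmemP

theorem Sim.create_other (h : C.Sim α β s s') {P' : Protocol S} {l : S.Label}
    {rest : List (Event S)} (hP' : P' ∈ C.Γ) (hne : P' ≠ C.R) (hr : P' r = some rs)
    (hev : rs.events = .create l r :: rest) (hinit : IsInitial P' rs inst)
    (hfresh : ∀ run ∈ s.runs, run.inst.rid ≠ inst.rid) (hi : inst.rid ∈ C.others) :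
    ∃ β' s'', C.Sim (α ++ [⟨inst, .create l r⟩]) β'
      ⟨s.know, insert ⟨rs, inst, rest⟩ s.runs⟩ s'' := by
  have hmem : .create l r ∈ rs.events := by rw [hev]; exact List.mem_cons_self
  have hinit' : IsInitial P' rs (C.pullOther rs inst) := by
    refine ⟨hinit.1, fun x => ?_⟩
    simp only [Inst.pull, id]
    split
    · next hx => simp [Inst.value, hx, hinit.2 x]
    · next hx => simp [Inst.value, hx, hinit.2 x]
    · next h1 h2 => simpa using h1
  refine ⟨_, _, h.create (Or.inr hP') (fun h' => C.notMemQ (h' ▸ hP')) hr hev hinit' hfresh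
    (Or.inr hi) rfl (fun _ => ⟨.other, ?_⟩) (.other (label_not_mem_R hP' hne hr hmem))
    (.other hP' hr hmem)⟩
  exact .other hP' hne hr hi (fun ev h' => by rw [hev]; exact List.mem_cons_of_mem _ h')
    (Or.inl rfl)

/-- One step of the chained system costs one step of the split system, except when the next event is
the first one taken from `Q`; then `Sim.handover` inserts two more in front. -/
theorem Sim.step {e : RunEvent S} {s₁ : State S} (h : C.Sim α β s s')
    (hA : Reached C.chainSet α s) (hs : Step C.chainSet s e s₁)
    (hfirst : ∀ run ∈ s₁.runs, ∀ r, C.R r = some run.spec → run.inst.rid ∈ C.first)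
    (hothers : ∀ run ∈ s₁.runs, ∀ P' ∈ C.Γ, P' ≠ C.R → ∀ r, P' r = some run.spec →
      run.inst.rid ∈ C.others) :
    ∃ β' s'', C.Sim (α ++ [e]) β' s₁ s'' := by
  obtain ⟨einst, eev⟩ := e
  obtain ⟨K₁, R₁⟩ := s₁
  rcases hs.cases_exec with ⟨P', hP', r, rs, l, rest, hr, hev, heev, hinit, hfresh, heq⟩ |
    ⟨rs, inst, rest, hrun, hex, heq⟩
  · dsimp only at heev hinit hfresh heq
    cases heq
    subst heev
    by_cases hR : P' = C.R
    · subst hR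
      have hi := hfirst _ (Or.inl rfl) r hr
      obtain ⟨rsP, rsQ, hP, hQ, rfl⟩ := chain_eq_some.1 hr
      exact h.create_first hP hQ hev hinit hfresh hi
    · have hΓ : P' ∈ C.Γ := hP'.resolve_left hR
      exact h.create_other hΓ hR hr hev hinit hfresh (hothers _ (Or.inl rfl) P' hΓ hR r hr)
  · dsimp only at hrun hex heq
    subst heq
    -- Stated for an arbitrary simulating trace, so that it applies both to a run already in its
    -- second phase and to one that was just handed over.
    have second : ∀ {β : Trace S} {s' : State S}, C.Sim α β s s' →
        C.Img s'.runs .second ⟨rs, inst, eev :: rest⟩ →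
        ∃ β' s'', C.Sim (α ++ [⟨einst, eev⟩]) β'
          ⟨K₁, replaceRun s.runs ⟨rs, inst, eev :: rest⟩ ⟨rs, einst, rest⟩⟩ s'' := by
      intro β s' h hph
      -- The run is generalized to a variable because case analysis cannot unify `eev :: rest` with
      -- the mapped lists in the indices of `Img`.
      obtain ⟨run, hrunA⟩ : ∃ run : Run S, ⟨rs, inst, eev :: rest⟩ = run := ⟨_, rfl⟩
      rw [hrunA] at hph
      cases hph with
      | @second r rsP rsQ inst₁ sB h1 h2 h3 h4 h5 h6 h7 =>
        obtain ⟨rfl, rfl, hrest⟩ := Run.mk.injEq .. ▸ hrunA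
        cases sB with
        | nil => cases hrest
        | cons ev sB =>
          rw [List.map_cons, List.cons.injEq] at hrest
          obtain ⟨rfl, hrest⟩ := hrest
          exact h.exec_second hA h1 h2 h3 h4 h5 h6 h7 hrest hrun hex
    obtain ⟨ph, hph⟩ := h.imgs _ hrun
    have hph' := hph
    obtain ⟨run, hrunA⟩ : ∃ run : Run S, ⟨rs, inst, eev :: rest⟩ = run := ⟨_, rfl⟩
    rw [hrunA] at hph
    cases hph with
    | other h1 h2 h3 h4 h5 h6 =>
      obtain ⟨rfl, rfl, rfl⟩ := Run.mk.injEq .. ▸ hrunA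
      exact h.exec_other hA h1 h2 h3 h4 h5 h6 hrun hex
    | @first r rsP rsQ inst₁ sB l h1 h2 h3 h4 h5 h6 h7 h8 =>
      obtain ⟨rfl, rfl, hrest⟩ := Run.mk.injEq .. ▸ hrunA
      cases sB with
      | nil =>
        rw [List.map_nil, List.nil_append] at hrest
        rw [hrest] at hrun
        obtain ⟨β', s'', h', himg⟩ := h.handover hA h1 h2 h3 (h4.subset (by simp)) h5 h6 h7 h8 hrun
        rw [← hrest] at himg
        exact second h' himg
      | cons ev sB =>
        rw [List.map_cons, List.cons_append, List.cons.injEq] at hrest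
        obtain ⟨rfl, hrest⟩ := hrest
        exact h.exec_first hA h1 h2 h3 h4 h5 h6 h7 h8 hrest hrun hex
    | second => exact second h hph'

theorem Sim.init (hIK₀ : ∀ Ps, IsInitialKnowledge (C.IK₀ Ps))
    (hknow : C.IK₀ C.chainSet ⊆ C.IK₀ C.splitSet) :
    C.Sim [] [] ⟨C.IK₀ C.chainSet, ∅⟩ ⟨C.IK₀ C.splitSet, ∅⟩ where
  deriv := .nil _
  know t ht := by
    rw [C.rename_τ_of_noRun (hIK₀ _) ht]
    exact hknow ht
  imgs _ h := h.elim
  rids _ h := h.elim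
  events := ⟨[], .refl _, .nil⟩
  source _ h := by cases h
  input := by
    rintro r ρ t j ⟨e, l, h, -⟩
    simp at h

/-- `first` and `others` are prescribed in advance by the final state. This suffices because runs
persist. -/
theorem Sim.derivation {α' : Trace S} {s₁ : State S} (h : C.Sim α β s s')
    (hA : Reached C.chainSet α s) (hd : Derivation C.chainSet s α' s₁)
    (hfirst : ∀ run ∈ s₁.runs, ∀ r, C.R r = some run.spec → run.inst.rid ∈ C.first)
    (hothers : ∀ run ∈ s₁.runs, ∀ P' ∈ C.Γ, P' ≠ C.R → ∀ r, P' r = some run.spec →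
      run.inst.rid ∈ C.others) :
    ∃ β' s'', C.Sim (α ++ α') β' s₁ s'' := by
  induction hd generalizing α β s' with
  | nil s => exact ⟨β, s', by simpa using h⟩
  | cons hs hd ih =>
    have hA' := (hA.step hs).1
    obtain ⟨-, hpers⟩ := hA'.derivation hd
    obtain ⟨β', s'', h'⟩ := h.step hA hs
      (fun run hrun r hr => by
        obtain ⟨run', hrun', h1, h2⟩ := hpers run hrun
        exact h1 ▸ hfirst run' hrun' r (h2 ▸ hr))
      (fun run hrun P' hP' hne r hr => by
        obtain ⟨run', hrun', h1, h2⟩ := hpers run hrun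
        exact h1 ▸ hothers run' hrun' P' hP' hne r (h2 ▸ hr))
    obtain ⟨β'', s''', h''⟩ := ih h' hA' hfirst hothers
    exact ⟨β'', s''', by simpa using h''⟩

end ChainSim

/-- Removing a finite set does not change the cardinality of an infinite type. A bijection `g` onto
the complement of `U ∪ V`, replaced by the identity on `V`, stays injective because `g` misses `V`.
-/
theorem exists_injective_avoiding {α : Type*} [Infinite α] {U V : Set α} (hU : U.Finite)
    (hV : V.Finite) (hUV : Disjoint U V) :
    ∃ π : α → α, Function.Injective π ∧ (∀ i ∈ V, π i = i) ∧ ∀ i ∈ U, π i ∉ U ∪ V := by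
  classical
  have hcard : Cardinal.mk α = Cardinal.mk ((U ∪ V)ᶜ : Set α) :=
    (Cardinal.mk_compl_of_infinite _ ((hU.union hV).lt_aleph0.trans_le
      (Cardinal.aleph0_le_mk α))).symm
  obtain ⟨g⟩ := Cardinal.eq.1 hcard
  have hg : ∀ i, (g i : α) ∉ U ∪ V := fun i => (g i).2
  refine ⟨fun i => if i ∈ V then i else g i, fun i j hij => ?_, fun i hi => if_pos hi,
    fun i hi => ?_⟩
  · dsimp only at hij
    split_ifs at hij with h1 h2 h2
    · exact hij
    · exact (hg j (hij ▸ Or.inr h1)).elim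
    · exact (hg i (hij ▸ Or.inr h2)).elim
    · exact g.injective (Subtype.ext hij)
  · dsimp only
    rw [if_neg (Set.disjoint_left.1 hUV hi)]
    exact hg i

theorem RoleSpec.WellFormed.create_mem {rs : RoleSpec S} {r r' : S.Role} {l : S.Label}
    (h : rs.WellFormed r) (hmem : .create l r' ∈ rs.events) : r' = r := by
  obtain ⟨⟨l₁, body, l₂, hev, hbody⟩, -⟩ := h
  rw [hev, List.mem_cons, List.mem_append, List.mem_singleton] at hmem
  rcases hmem with h' | h' | h'
  · cases h'; rfl
  · exact (hbody _ h').elim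
  · cases h'

/-! ### Transfer of the claims to the chained system -/

namespace ChainSim

variable {C : ChainSim S}

/-- `X` is a part of the chaining composition, whose instantiations are obtained from those of the
chaining composition by means of `g` and `p`. -/
structure Part (C : ChainSim S) (X : Protocol S) (g : S.Ident → S.Ident)
    (p : S.RunId → S.RunId) : Prop where
  mem : X ∈ C.splitSet
  p_injective : Function.Injective p
  dom_eq : X.dom = C.R.dom
  img : ∀ {r rs l r₁ cl m}, X r = some rs → .claim l r₁ cl (some m) ∈ rs.events →
    ∃ rsR, C.R r = some rsR ∧
      .claim (C.lam l) r₁ cl (some (RoleTerm.rename g m)) ∈ rsR.events ∧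
      ∀ e e', C.EventImg e e' → e.ev.label = C.lam l →
        e.ev = .claim (C.lam l) r₁ cl (some (RoleTerm.rename g m)) ∧
        e'.ev = .claim l r₁ cl (some m) ∧ e'.inst = e.inst.pull rsR.typ rs.typ g C.τ p ∧
        ∀ i, ConstCompat rsR.typ rs.typ g C.τ p i
  source : ∀ {r rs α e'}, X r = some rs → e'.ev ∈ rs.events → C.Source α e' →
    ∃ rsR, C.R r = some rsR ∧ ∃ e ∈ α, e.ev ∈ rsR.events ∧
      e'.inst = e.inst.pull rsR.typ rs.typ g C.τ p ∧ ∀ i, ConstCompat rsR.typ rs.typ g C.τ p i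

theorem exists_Q {r : S.Role} {rsP : RoleSpec S} (hP : C.P r = some rsP) :
    ∃ rsQ, C.Q r = some rsQ := by
  rw [← Option.isSome_iff_exists]
  have : r ∈ C.P.dom := by rw [Protocol.dom, Set.mem_ofPred_eq, hP]; rfl
  rwa [C.defined.dom_eq] at this

theorem exists_P {r : S.Role} {rsQ : RoleSpec S} (hQ : C.Q r = some rsQ) :
    ∃ rsP, C.P r = some rsP := by
  rw [← Option.isSome_iff_exists]
  have : r ∈ C.Q.dom := by rw [Protocol.dom, Set.mem_ofPred_eq, hQ]; rfl
  rwa [← C.defined.dom_eq] at this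

theorem dom_R : C.R.dom = C.P.dom := by
  ext r
  simp only [Protocol.dom, Set.mem_ofPred_eq, Option.isSome_iff_exists, chain_eq_some]
  constructor
  · rintro ⟨_, rsP, _, hP, -⟩
    exact ⟨rsP, hP⟩
  · rintro ⟨rsP, hP⟩
    obtain ⟨rsQ, hQ⟩ := exists_Q hP
    exact ⟨_, rsP, rsQ, hP, hQ, rfl⟩

/-- Injectivity of `lam` recovers the original label, and a claim label determines its event. The
labels of `Q` are disjoint from those of `P`, and `P ∉ Γ` excludes events of other protocols as
sources. -/
theorem part_first (hlam : Set.InjOn C.lam (C.P.labels ∪ C.Q.labels)) :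
    C.Part C.P id id where
  mem := mem_P
  p_injective := Function.injective_id
  dom_eq := dom_R.symm
  img := by
    intro r rsP l r₁ cl m hP hmem
    obtain ⟨rsQ, hQ⟩ := exists_Q hP
    have hR : Event.claim (C.lam l) r₁ cl (some (RoleTerm.rename id m)) ∈
        (C.spec rsP rsQ).events := by
      obtain ⟨⟨lP, body, lP', hbody, -⟩, -⟩ := (C.split.1 _ mem_P).1 r rsP hP
      rw [chainSpec_events C.lam C.c C.d rsQ
        (show rsP.events = (.create lP r :: body) ++ [.finish lP' r] from hbody)]
      rw [hbody] at hmem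
      refine List.mem_append_left _ (List.mem_map.2 ⟨.claim l r₁ cl (some m), ?_, rfl⟩)
      simpa using hmem
    refine ⟨_, spec_mem hP hQ, hR, fun e e' hee' hl => ?_⟩
    have hlP : l ∈ C.P.labels := ⟨r, rsP, hP, _, hmem, rfl⟩
    cases hee' with
    | other h => exact (h ⟨r, _, spec_mem hP hQ, _, hR, hl.symm⟩).elim
    | @first r' rsP' rsQ' inst ev h1 h2 h3 =>
      rw [Event.label_map] at hl
      have hl := hlam (Or.inl ⟨_, _, h1, _, h3, rfl⟩) (Or.inl hlP) hl
      obtain ⟨rfl, rfl⟩ := (C.split.1 _ mem_P).eq_of_label_claim h1 hP h3 hmem hl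
      obtain rfl := Option.some.inj (h1.symm.trans hP)
      obtain rfl := Option.some.inj (h2.symm.trans hQ)
      exact ⟨rfl, rfl, rfl, constCompat_first hP⟩
    | @second r' rsP' rsQ' inst ev h1 h2 h3 h4 =>
      rw [Event.label_map] at hl
      have hl := hlam (Or.inr ⟨_, _, h2, _, h4, rfl⟩) (Or.inl hlP) hl
      exact (Set.disjoint_left.1 (C.split.2 _ mem_P _ mem_Q (P_ne_Q hQ)) hlP
        ⟨_, _, h2, _, h4, hl⟩).elim
  source := by
    intro r rs α e' hr he' hs
    cases hs with
    | @other P' _ _ _ h1 h2 h3 =>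
      exact (C.notMemP ((C.split.spec_unique (Or.inr h1) mem_P h2 hr h3 he').1 ▸ h1)).elim
    | @first r' rsP rsQ e ev h1 h2 h3 h4 h5 =>
      obtain ⟨-, rfl, rfl⟩ := C.split.spec_unique mem_P mem_P h1 hr h3 he'
      exact ⟨_, spec_mem h1 h2, e, h4, h5, rfl, constCompat_first h1⟩
    | second h1 h2 h3 h4 =>
      exact (P_ne_Q h2 (C.split.spec_unique mem_P mem_Q hr h2 he' h4).1).elim

theorem part_second (hlam : Set.InjOn C.lam (C.P.labels ∪ C.Q.labels)) :
    C.Part C.Q (identSubst C.c C.d) C.π where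
  mem := mem_Q
  p_injective := C.π_injective
  dom_eq := by rw [dom_R, C.defined.dom_eq]
  img := by
    intro r rsQ l r₁ cl m hQ hmem
    obtain ⟨rsP, hP⟩ := exists_P hQ
    have hR : Event.claim (C.lam l) r₁ cl (some (RoleTerm.rename (identSubst C.c C.d) m)) ∈
        (C.spec rsP rsQ).events := by
      obtain ⟨⟨lP, body, lP', hbody, -⟩, -⟩ := (C.split.1 _ mem_P).1 r rsP hP
      obtain ⟨⟨lQ, body', lQ', hbody', -⟩, -⟩ := (C.split.1 _ mem_Q).1 r rsQ hQ
      rw [chainSpec_events C.lam C.c C.d rsQ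
        (show rsP.events = (.create lP r :: body) ++ [.finish lP' r] from hbody), hbody']
      rw [hbody'] at hmem
      refine List.mem_append_right _ (List.mem_map.2 ⟨.claim l r₁ cl (some m), ?_, rfl⟩)
      simpa using hmem
    refine ⟨_, spec_mem hP hQ, hR, fun e e' hee' hl => ?_⟩
    have hlQ : l ∈ C.Q.labels := ⟨r, rsQ, hQ, _, hmem, rfl⟩
    cases hee' with
    | other h => exact (h ⟨r, _, spec_mem hP hQ, _, hR, hl.symm⟩).elim
    | @first r' rsP' rsQ' inst ev h1 h2 h3 =>
      rw [Event.label_map] at hl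
      have hl := hlam (Or.inl ⟨_, _, h1, _, h3, rfl⟩) (Or.inr hlQ) hl
      exact (Set.disjoint_left.1 (C.split.2 _ mem_P _ mem_Q (P_ne_Q hQ))
        ⟨_, _, h1, _, h3, hl⟩ hlQ).elim
    | @second r' rsP' rsQ' inst ev h1 h2 h3 h4 =>
      rw [Event.label_map] at hl
      have hl := hlam (Or.inr ⟨_, _, h2, _, h4, rfl⟩) (Or.inr hlQ) hl
      obtain ⟨rfl, rfl⟩ := (C.split.1 _ mem_Q).eq_of_label_claim h2 hQ h4 hmem hl
      obtain rfl := Option.some.inj (h1.symm.trans hP)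
      obtain rfl := Option.some.inj (h2.symm.trans hQ)
      exact ⟨rfl, rfl, rfl, constCompat_second hP hQ h3⟩
  source := by
    intro r rs α e' hr he' hs
    cases hs with
    | @other P' _ _ _ h1 h2 h3 =>
      exact (C.notMemQ ((C.split.spec_unique (Or.inr h1) mem_Q h2 hr h3 he').1 ▸ h1)).elim
    | first h1 h2 h3 =>
      exact (P_ne_Q h2 (C.split.spec_unique mem_P mem_Q h1 hr h3 he').1).elim
    | @second r' rsP rsQ e ev h1 h2 h3 h4 h5 h6 =>
      obtain ⟨-, rfl, rfl⟩ := C.split.spec_unique mem_Q mem_Q h2 hr h4 he'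
      exact ⟨_, spec_mem h1 h2, e, h5, h6, rfl, constCompat_second h1 h2 h3⟩

theorem Sim.exists_embedding {α β : Trace S} {s s' : State S} (h : C.Sim α β s s') :
    ∃ f : ℕ ↪o ℕ, ∀ i e, α[i]? = some e → ∃ e', β[f i]? = some e' ∧ C.EventImg e e' := by
  obtain ⟨β', h1, h2⟩ := h.events
  obtain ⟨f, hf⟩ := List.sublist_iff_exists_orderEmbedding_getElem?_eq.1 h1
  refine ⟨f, fun i e hi => ?_⟩
  obtain ⟨hlt, rfl⟩ := List.getElem?_eq_some_iff.1 hi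
  have hlt' : i < β'.length := h2.length_eq ▸ hlt
  exact ⟨β'[i], by rw [← hf, List.getElem?_eq_getElem hlt'], h2.get hlt hlt'⟩

section Transfer

variable {X : Protocol S} {g : S.Ident → S.Ident} {p : S.RunId → S.RunId} {α β : Trace S}
  {s s' : State S} {r r₁ : S.Role} {rs rsR : RoleSpec S} {l : S.Label} {cl : ClaimName S}
  {m : RoleTerm S} {inst : Inst S}

/-- Claim events of `α` with equal values have images with equal renamed values. These images
coincide in `β`, and the embedding of positions is injective. -/
theorem Part.sessionUnique (hX : C.Part X g p) (h : C.Sim α β s s') (hr : X r = some rs)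
    (hmem : .claim l r₁ cl (some m) ∈ rs.events) (hR : C.R r = some rsR)
    (hmemR : .claim (C.lam l) r₁ cl (some (RoleTerm.rename g m)) ∈ rsR.events)
    (hc : ConstCompat rsR.typ rs.typ g C.τ p inst.rid)
    (hβ : SecProt.sessionUnique C.splitSet (.claim l r₁ cl (some m))
      (inst.pull rsR.typ rs.typ g C.τ p) β) :
    SecProt.sessionUnique C.chainSet (.claim (C.lam l) r₁ cl (some (RoleTerm.rename g m)))
      inst α := by
  obtain ⟨f, hf⟩ := h.exists_embedding
  obtain ⟨rsR', hR', -, himg⟩ := hX.img hr hmem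
  obtain rfl := Option.some.inj (hR.symm.trans hR')
  have htyped := idents_typed C.split hX.mem hr hmem
  have hval : ∀ {inst : Inst S} {t}, ConstCompat rsR.typ rs.typ g C.τ p inst.rid →
      HasValue C.chainSet ⟨inst, .claim (C.lam l) r₁ cl (some (RoleTerm.rename g m))⟩
        (RoleTerm.rename g m) t →
      HasValue C.splitSet ⟨inst.pull rsR.typ rs.typ g C.τ p, .claim l r₁ cl (some m)⟩ m
        (RunTerm.rename C.τ t) := by
    intro inst t hc hv
    refine ⟨X, hX.mem, r, rs, hr, hmem, ?_⟩
    rw [Inst.apply_pull hc htyped]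
    have := hv.apply C.chained mem_R hR hmemR
    dsimp only at this
    rw [this]
    rfl
  have hstep : ∀ {i e t}, α[i]? = some e →
      (∃ cl x, e.ev = .claim (C.lam l) r₁ cl x) →
      HasValue C.chainSet e (RoleTerm.rename g m) t →
      ∃ e', β[f i]? = some e' ∧ (∃ cl x, e'.ev = .claim l r₁ cl x) ∧
        HasValue C.splitSet e' m (RunTerm.rename C.τ t) := by
    rintro i e t hi ⟨cl', x, hx⟩ hv
    obtain ⟨e', hi', hee'⟩ := hf i e hi
    obtain ⟨h1, h2, h3, h4⟩ := himg e e' hee' (by rw [hx]; rfl)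
    refine ⟨e', hi', ⟨_, _, h2⟩, ?_⟩
    obtain ⟨einst, eev⟩ := e
    obtain ⟨einst', eev'⟩ := e'
    dsimp only at h1 h2 h3
    subst h1 h2 h3
    exact hval (h4 _) hv
  intro i j ei ej t hi hj hci hcj hvi hvj hv
  obtain ⟨ei', h1, h2, h3⟩ := hstep hi hci hvi
  obtain ⟨ej', h1', h2', h3'⟩ := hstep hj hcj hvj
  exact f.injective (hβ _ _ _ _ _ h1 h1' h2 h2' h3 h3' (hval hc hv))

/-- The runs of the cast in `β` are halves of chained runs. Undoing `p` on their identifiers gives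
the cast in `α`. -/
theorem Part.dataAgree (hX : C.Part X g p) (h : C.Sim α β s s') (hA : Reached C.chainSet α s)
    (hr : X r = some rs)
    (hmem : .claim l r₁ cl (some m) ∈ rs.events) (hR : C.R r = some rsR)
    (hmemR : .claim (C.lam l) r₁ cl (some (RoleTerm.rename g m)) ∈ rsR.events)
    (hc : ConstCompat rsR.typ rs.typ g C.τ p inst.rid)
    (hβ : SecProt.dataAgree C.splitSet (.claim l r₁ cl (some m))
      (inst.pull rsR.typ rs.typ g C.τ p) β) :
    SecProt.dataAgree C.chainSet (.claim (C.lam l) r₁ cl (some (RoleTerm.rename g m)))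
      inst α := by
  have hB : Reached C.splitSet β s' := by
    simpa using ((Reached.init C.splitSet (C.IK₀ C.splitSet)).derivation h.deriv).1
  obtain ⟨X', hX', hl, κ, ⟨ρ, hcast⟩, hdata⟩ := hβ
  have hXeq : ∀ {X'}, X' ∈ C.splitSet → ∀ {l}, l ∈ X'.labels → l ∈ X.labels → X' = X := by
    intro X' hX' l hl hl'
    by_contra hne
    exact Set.disjoint_left.1 (C.split.2 _ hX' _ hX.mem hne) hl hl'
  obtain rfl := hXeq hX' hl ⟨r, rs, hr, _, hmem, rfl⟩
  have key : ∀ r' ∈ C.R.dom, ∃ i,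
      (∃ e ∈ α, ∃ l ∈ C.R.labels, e.inst.rid = i ∧ e.inst.ρ = ρ ∧ e.ev = .create l r') ∧
      ∃ e ∈ α, e.inst.rid = i ∧ ∃ t, HasValue C.chainSet e (RoleTerm.rename g m) t ∧
        HasValue C.chainSet ⟨inst, .claim (C.lam l) r₁ cl (some (RoleTerm.rename g m))⟩
          (RoleTerm.rename g m) t := by
    intro r' hr'
    rw [← hX.dom_eq] at hr'
    obtain ⟨ec, hec, lc, hlc, hrid, hρ, hev⟩ := hcast r' hr'
    obtain ⟨ed, hed, hrid', t', hv, hv'⟩ := hdata r' hr'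
    obtain ⟨run, hrun, h1, -, h3⟩ := hB.owner ec hec
    obtain ⟨run', hrun', h1', -, h3'⟩ := hB.owner ed hed
    -- The create event and the event that carries the data have the same run identifier, hence
    -- belong to the same run and the same role of `X`.
    obtain rfl := hB.eq_of_rid _ hrun _ hrun' (by rw [h1, h1', hrid, hrid'])
    obtain ⟨P₂, hP₂, r₂, hr₂, -⟩ := hB.created run hrun
    obtain rfl := hXeq hP₂ ⟨r₂, _, hr₂, _, h3, by rw [hev]; rfl⟩ hlc
    obtain rfl := ((C.split.1 _ hX.mem).1 _ _ hr₂).create_mem (hev ▸ h3)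
    obtain ⟨rsR', hR', e₀, he₀, hev₀, hinst₀, -⟩ := hX.source hr₂ h3 (h.source ec hec)
    obtain ⟨rsR'', hR'', e₁, he₁, hev₁, hinst₁, hc₁⟩ := hX.source hr₂ h3' (h.source ed hed)
    obtain rfl := Option.some.inj (hR'.symm.trans hR'')
    have hrid₀ : e₁.inst.rid = e₀.inst.rid := by
      refine hX.p_injective ?_
      have h0 : ec.inst.rid = p e₀.inst.rid := by rw [hinst₀]; rfl
      have h1 : ed.inst.rid = p e₁.inst.rid := by rw [hinst₁]; rfl
      rw [← h0, ← h1, hrid, hrid']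
    refine ⟨e₀.inst.rid, ?_, e₁, he₁, hrid₀, ?_⟩
    -- The source `e₀` need not be a create event: for `Q` it is a later event of the chained run.
    -- The create event required by the cast is that of the run owning `e₀`.
    · obtain ⟨run₀, hrun₀, ha, hb, hc'⟩ := hA.owner e₀ he₀
      obtain ⟨P₃, hP₃, r₃, hr₃, e, he, le, hle, hmem', hd, hd'⟩ := hA.created run₀ hrun₀
      obtain ⟨rfl, rfl, -⟩ := C.chained.spec_unique hP₃ mem_R hr₃ hR' hc' hev₀
      refine ⟨e, he, le, ⟨_, _, hr₃, _, hmem', by rw [hle]; rfl⟩, hd.trans ha, ?_, hle⟩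
      rw [hd', hb, ← hρ, hinst₀]
      rfl
    · have hv := hv.apply C.split hX.mem hr₂ h3'
      have hv' := hv'.apply C.split hX.mem hr hmem
      rw [hinst₁] at hv
      obtain ⟨t₁, ht₁, htt₁⟩ := Inst.exists_apply_of_pull (hc₁ _) hv
      obtain ⟨t₂, ht₂, htt₂⟩ := Inst.exists_apply_of_pull hc hv'
      -- The values agree in `β` after renaming; injectivity of `τ` makes them agree in `α`.
      obtain rfl := RunTerm.rename_injective C.τ_injective (htt₁.trans htt₂.symm)
      exact ⟨t₁, ⟨_, mem_R, _, _, hR', hev₁, ht₁⟩, ⟨_, mem_R, _, _, hR, hmemR, ht₂⟩⟩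
  have : Nonempty S.RunId := ⟨inst.rid⟩
  choose! κ' hκ₁ hκ₂ using key
  exact ⟨C.R, mem_R, ⟨r, rsR, hR, _, hmemR, rfl⟩, κ', ⟨ρ, hκ₁⟩, hκ₂⟩

theorem Part.claim (hX : C.Part X g p) (h : C.Sim α β s s') (hA : Reached C.chainSet α s)
    {f : SecurityProperty S}
    (hf : (cl = .sessionUnique ∧ f = SecProt.sessionUnique) ∨
      (cl = .dataAgree ∧ f = SecProt.dataAgree))
    (hl : X.HasClaim cl l)
    (hsat : Satisfies C.IK₀ C.splitSet (UniqueInput {C.P} {C.Q} C.c C.d) cl f l)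
    {x : Option (RoleTerm S)} (he : ⟨inst, .claim (C.lam l) r₁ cl x⟩ ∈ α) :
    f C.chainSet (.claim (C.lam l) r₁ cl x) inst α ∨
      ¬ {a | ∃ r', inst.ρ r' = some a} ⊆ S.trusted := by
  obtain ⟨r, rs, m, hr, hmem⟩ := hl
  obtain ⟨rsR, hR, hmemR, himg⟩ := hX.img hr hmem
  obtain ⟨i, hi⟩ := List.mem_iff_getElem?.1 he
  obtain ⟨emb, hemb⟩ := h.exists_embedding
  obtain ⟨⟨inst', ev'⟩, hi', hee'⟩ := hemb i _ hi
  obtain ⟨h1, h2, h3, h4⟩ := himg _ _ hee' rfl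
  dsimp only at h1 h2 h3
  subst h2 h3
  cases h1
  have := hsat β ⟨_, h.deriv⟩ h.input.uniqueInput _ _ _ (List.mem_iff_getElem?.2 ⟨_, hi'⟩)
  -- The pulled instantiation keeps the role assignment, so the condition on trusted agents is
  -- literally the same.
  refine this.imp (fun hβ => ?_) id
  rcases hf with ⟨-, rfl⟩ | ⟨-, rfl⟩
  · exact hX.sessionUnique h hr hmem hR hmemR (h4 _) hβ
  · exact hX.dataAgree h hA hr hmem hR hmemR (h4 _) hβ

end Transfer

end ChainSim

end SecProt

theorem mainTheorem8 (S : Signature.{u})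
    (IK₀ : Set (Protocol S) → Set (RunTerm S)) (hIK₀ : ∀ Ps, IsInitialKnowledge (IK₀ Ps))
    (P Q : Protocol S) (Γ : Set (Protocol S)) (c d : S.Ident) (lam : S.Label → S.Label)
    (hPQ : ChainDefined IK₀ P Q c d)
    (hPΓ : P ∉ Γ) (hQΓ : Q ∉ Γ)
    (hlam : Set.InjOn lam (P.labels ∪ Q.labels))
    (hsplit : IsProtocolSet ({P, Q} ∪ Γ))
    (hchain : IsProtocolSet ({chain lam P Q c d} ∪ Γ))
    (hknow : IK₀ ({chain lam P Q c d} ∪ Γ) ⊆ IK₀ ({P, Q} ∪ Γ))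
    (cl : ClaimName S) (f : SecurityProperty S)
    (hcl : (cl = .sessionUnique ∧ f = sessionUnique) ∨ (cl = .dataAgree ∧ f = dataAgree))
    (l : S.Label) (hl : P.HasClaim cl l ∨ Q.HasClaim cl l) :
    Satisfies IK₀ ({P, Q} ∪ Γ) (UniqueInput {P} {Q} c d) cl f l →
      Satisfies IK₀ ({chain lam P Q c d} ∪ Γ) (fun _ => True) cl f (lam l) := by
  rintro hsat α ⟨s, hd⟩ - inst r x he
  have hA := ((Reached.init ({chain lam P Q c d} ∪ Γ) (IK₀ _)).derivation hd).1
  rw [List.nil_append] at hA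
  have := S.infinite_runId
  -- `U` and `V` collect the run identifiers of the final state: those of chained runs, which get
  -- new ones, and those of all other runs, which keep theirs.
  obtain ⟨π, hπ, hπV, hπU⟩ := exists_injective_avoiding
    (U := (fun run : Run S => run.inst.rid) ''
      {run ∈ s.runs | ∃ r, chain lam P Q c d r = some run.spec})
    (V := (fun run : Run S => run.inst.rid) ''
      {run ∈ s.runs | ¬ ∃ r, chain lam P Q c d r = some run.spec})
    ((hA.finite.subset (Set.sep_subset _ _)).image _)
    ((hA.finite.subset (Set.sep_subset _ _)).image _)
    (by
      rw [Set.disjoint_left]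
      rintro _ ⟨run, ⟨hrun, hr⟩, rfl⟩ ⟨run', ⟨hrun', hr'⟩, hrid⟩
      exact hr' (hA.eq_of_rid _ hrun' _ hrun hrid ▸ hr))
  let C : ChainSim S := ⟨IK₀, P, Q, Γ, c, d, lam, hPQ, hPΓ, hQΓ, hsplit, hchain, _, _, π, hπ, hπV,
    hπU⟩
  obtain ⟨β, s', h⟩ := (ChainSim.Sim.init (C := C) hIK₀ hknow).derivation (Reached.init _ _) hd
    (fun run hrun r hr => ⟨run, ⟨hrun, r, hr⟩, rfl⟩)
    (by
      -- A run of another protocol cannot share its specification with a chained run, because an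
      -- executed event of it belongs to only one protocol.
      refine fun run hrun P' hP' hne r hr => ⟨run, ⟨hrun, ?_⟩, rfl⟩
      rintro ⟨r', hr'⟩
      obtain ⟨e, -, he⟩ := hA.last run hrun
      exact hne (hchain.spec_unique (Or.inr hP') (Or.inl rfl) hr hr' he.2 he.2).1)
  rw [List.nil_append] at h
  rcases hl with hl | hl
  · exact (ChainSim.part_first (C := C) hlam).claim h hA hcl hl hsat he
  · exact (ChainSim.part_second (C := C) hlam).claim h hA hcl hl hsat he
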